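/- **Setting.** Let $K$ be a field, $V$ a $K$-vector space with basis $e_1,\dots,e_n$, and $E=\bigwedge V$ its exterior algebra, graded by $\deg e_i=1$; products in $E$ are written by juxtaposition. For $\mu=\{i_1<\dots<i_d\}\subseteq[n]$ put $e_\mu=e_{i_1}\cdots e_{i_d}$ (with $e_\emptyset=1$), $\operatorname{supp}(e_\mu)=\mu$, $\deg e_\mu=d$; the elements $\pm e_\mu$ are called monomials. If $v,w$ are monomials with $\operatorname{supp}(v)\subseteq\operatorname{supp}(w)$, then $\frac{w}{v}$ denotes the unique monomial $w'$ with $w'v=w$. An ideal $I$ is a monomial ideal if it is generated by monomials; $G(I)$ is the set of those $e_\mu\in I$ such that $e_\nu\notin I$ for all $\nu\subsetneq\mu$. For an ideal $J$ and $m\in E$ put $J:(m)=\{x\in E: xm\in J\}$. Let $I\neq E$ be a monomial ideal, and let $u_1,\dots,u_r$ be an ordering of the elements of $G(I)$. Assume that $I$ has linear quotients with respect to this order: for every $j=1,\dots,r$ the ideal $(u_1,\dots,u_{j-1}):(u_j)$ (which is $0:(u_1)$ for $j=1$) is generated by a subset of $\{e_1,\dots,e_n\}$. Put $\operatorname{set}(u_j)=\{k\in[n]: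 e_k\in(u_1,\dots,u_{j-1}):(u_j)\}$. For a monomial $m\in I$ let $g(m)=u_j$, where $j$ is the smallest index with $m\in(u_1,\dots,u_j)$. Assume that this decomposition function $g$ is regular, i.e. $\operatorname{set}(g(e_su))\subseteq\operatorname{set}(u)$ for all $u\in G(I)$ and all $s\in\operatorname{set}(u)\setminus\operatorname{supp}(u)$. For $a\in\mathbb N^n$ let $|a|=\sum_k a_k$ and $\operatorname{supp}(a)=\{k: a_k\ne0\}$, and let $\varepsilon_1,\dots,\varepsilon_n$ be the canonical basis of $\mathbb N^n$. Let $F_0=E$, and for $i\ge1$ let $F_i$ be the graded free $E$-module with homogeneous basis the symbols $f(a;u)$ with $u\in G(I)$, $\operatorname{supp}(a)\subseteq\operatorname{set}(u)$, $|a|=i-1$, where $\deg f(a;u)=|a|+\deg u$. Put $f(a;u)=0$ if $\operatorname{supp}(a)\not\subseteq\operatorname{set}(u)$. Let $d:F_i\to F_{i-1}$ ($i\ge1$) be the $E$-linear maps with $$d(f(0;u))=(-1)^{\deg u}\,u\qquad(u\in G(I)),$$ and, for $u\in G(I)$, $a\neq0$, $\operatorname{supp}(a)\subseteq\operatorname{set}(u)$,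 $$d(f(a;u))=-\sum_{t\in\operatorname{supp}(a)}(-1)^{\deg u}e_t\,f(a-\varepsilon_t;u)+\sum_{t\in\operatorname{supp}(a)\setminus\operatorname{supp}(u)}(-1)^{\deg g(e_tu)}\,\frac{e_tu}{g(e_tu)}\,f(a-\varepsilon_t;g(e_tu)).$$ **Theorem 4.4.** The complex $\cdots\to F_2\to F_1\to F_0$ with these maps, together with the canonical map $F_0=E\to E/I$, is a minimal graded free resolution of $E/I$. Consequently the maps of the minimal graded free resolution of $E/I$ are given by these formulas: if $(X_\bullet,\delta)$ with augmentation $X_0\to E/I$ is any minimal graded free resolution of $E/I$, then $X_0$ has a basis consisting of one element of degree $0$ that maps to the class of $1$ (so that $X_0$ is identified with $E$), and the modules $X_i$, $i\ge1$, have homogeneous bases $f(a;u)$, indexed and of degrees as above, such that $\delta$ is given on them by the formulas above. -/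

import Mathlib

namespace ExtRes

noncomputable section

open scoped Classical

/-! ### Monomials of the exterior algebra `E = ⋀ V` with respect to a basis `e₁, …, eₙ` of `V` -/

section Monomials

variable {K V : Type*} [Field K] [AddCommGroup V] [Module K V] {n : ℕ}

/-- The generator `e_i` of `E`. -/
def gen (e : Module.Basis (Fin n) K V) (i : Fin n) : ExteriorAlgebra K V :=
  ExteriorAlgebra.ι K (e i)

/-- The monomial `e_μ = e_{i₁} ∧ ⋯ ∧ e_{i_d}` for `μ = {i₁ < ⋯ < i_d}`. Its support is `μ` and its
degree is `μ.card`. -/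
def mono (e : Module.Basis (Fin n) K V) (μ : Finset (Fin n)) : ExteriorAlgebra K V :=
  ((μ.sort (· ≤ ·)).map (gen e)).prod

/-- Monomials up to sign: the elements `e_μ` and `-e_μ`. -/
def IsMonomial (e : Module.Basis (Fin n) K V) (w : ExteriorAlgebra K V) : Prop :=
  ∃ μ : Finset (Fin n), w = mono e μ ∨ w = -mono e μ

/-- The quotient `m / v` of monomials (with `supp v ⊆ supp m`): the unique monomial `w`, up to sign
a product of basis vectors, with `w * v = m`. It is `0` when there is no such `w`. -/
def monQuot (e : Module.Basis (Fin n) K V) (m v : ExteriorAlgebra K V) : ExteriorAlgebra K V :=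
  if h : ∃ w, IsMonomial e w ∧ w * v = m then h.choose else 0

/-- `I` is generated by monomials. (A left ideal generated by monomials is two-sided.) -/
def IsMonomialIdeal (e : Module.Basis (Fin n) K V) (I : Ideal (ExteriorAlgebra K V)) : Prop :=
  ∃ A : Set (Finset (Fin n)), I = Ideal.span (mono e '' A)

/-- The supports of the minimal monomial generators of `I`: the monomials of `I` none of whose
proper divisors lies in `I`. -/
def minGens (e : Module.Basis (Fin n) K V) (I : Ideal (ExteriorAlgebra K V)) :
    Set (Finset (Fin n)) :=
  {μ | mono e μ ∈ I ∧ ∀ ν, ν ⊂ μ → mono e ν ∉ I}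

/-- The colon ideal `J : (m) = {x | x m ∈ J}`. -/
def colon (J : Ideal (ExteriorAlgebra K V)) (m : ExteriorAlgebra K V) :
    Ideal (ExteriorAlgebra K V) :=
  Submodule.comap (LinearMap.toSpanSingleton (ExteriorAlgebra K V) (ExteriorAlgebra K V) m) J

end Monomials

/-! ### Linear quotients. Here `u₁, …, u_r` is a sequence of monomials, given by their supports. -/

section LinearQuotients

variable {K V : Type*} [Field K] [AddCommGroup V] [Module K V] {n r : ℕ}

/-- `u` lists the elements of `G(I)`, each exactly once. -/
def EnumeratesMinGens (e : Module.Basis (Fin n) K V) (I : Ideal (ExteriorAlgebra K V))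
    (u : Fin r → Finset (Fin n)) : Prop :=
  Function.Injective u ∧ Set.range u = minGens e I

/-- The ideal `(u_i : i < j)`; it is `0` for the first index `j`. -/
def idealLT (e : Module.Basis (Fin n) K V) (u : Fin r → Finset (Fin n)) (j : Fin r) :
    Ideal (ExteriorAlgebra K V) :=
  Ideal.span ((fun i => mono e (u i)) '' {i | i < j})

/-- The ideal `I_j = (u_i : i ≤ j)`. -/
def idealLE (e : Module.Basis (Fin n) K V) (u : Fin r → Finset (Fin n)) (j : Fin r) :
    Ideal (ExteriorAlgebra K V) :=
  Ideal.span ((fun i => mono e (u i)) '' {i | i ≤ j})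

/-- Linear quotients with respect to the order `u₁, …, u_r`: every ideal
`(u_1, …, u_{j-1}) : (u_j)` (for the first index, `0 : (u_1)`) is generated by a subset of
`{e_1, …, e_n}`. -/
def HasLinearQuotients (e : Module.Basis (Fin n) K V) (u : Fin r → Finset (Fin n)) : Prop :=
  ∀ j, ∃ A : Set (Fin n), colon (idealLT e u j) (mono e (u j)) = Ideal.span (gen e '' A)

/-- `set(u_j) = {k | e_k ∈ (u_1, …, u_{j-1}) : (u_j)}`. -/
def quotSet (e : Module.Basis (Fin n) K V) (u : Fin r → Finset (Fin n)) (j : Fin r) :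
    Set (Fin n) :=
  {k | gen e k ∈ colon (idealLT e u j) (mono e (u j))}

/-- The decomposition function: the smallest index `i` with `m ∈ I_i`, so that `g(m) = u_i`.
The index `j` is only a default value, returned when `m` lies in no `I_i`. -/
def decomp (e : Module.Basis (Fin n) K V) (u : Fin r → Finset (Fin n)) (j : Fin r)
    (m : ExteriorAlgebra K V) : Fin r :=
  if h : (Finset.univ.filter fun i => m ∈ idealLE e u i).Nonempty then
    (Finset.univ.filter fun i => m ∈ idealLE e u i).min' h
  else j

/-- The index of `g(e_t u_j)`. -/
def next (e : Module.Basis (Fin n) K V) (u : Fin r → Finset (Fin n)) (t : Fin n) (j : Fin r) :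
    Fin r :=
  decomp e u j (gen e t * mono e (u j))

/-- The decomposition function is regular: `set(g(e_s u)) ⊆ set(u)` for all `u ∈ G(I)` and
`s ∈ set(u) \ supp(u)`. -/
def IsRegularDecomp (e : Module.Basis (Fin n) K V) (u : Fin r → Finset (Fin n)) : Prop :=
  ∀ j, ∀ s ∈ quotSet e u j, s ∉ u j → quotSet e u (next e u s j) ⊆ quotSet e u j

end LinearQuotients

/-! ### Minimal graded free resolutions over `E` -/

section Resolutions

variable {K V : Type*} [Field K] [AddCommGroup V] [Module K V]

/-- The component `E_k` of `E`, for `k ∈ ℤ`; it is `0` for `k < 0`. -/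
def degPart (K V : Type*) [Field K] [AddCommGroup V] [Module K V] (k : ℤ) :
    AddSubgroup (ExteriorAlgebra K V) :=
  if 0 ≤ k then (⋀[K]^k.toNat V).toAddSubgroup else ⊥

/-- The component `(E/I)_k`, the image of `E_k`. -/
def quotDegPart (I : Ideal (ExteriorAlgebra K V)) (k : ℤ) :
    AddSubgroup (ExteriorAlgebra K V ⧸ I) :=
  (degPart K V k).map (Submodule.mkQ I).toAddMonoidHom

/-- `M = ⨁ₖ M_k` is a `ℤ`-graded `E`-module. -/
def IsGradedModule {M : Type*} [AddCommGroup M] [Module (ExteriorAlgebra K V) M]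
    (gr : ℤ → AddSubgroup M) : Prop :=
  DirectSum.IsInternal gr ∧
    ∀ (i k : ℤ), ∀ x ∈ degPart K V i, ∀ m ∈ gr k, x • m ∈ gr (i + k)

/-- `M` has an `E`-basis of homogeneous elements. -/
def IsGradedFree (K V : Type*) [Field K] [AddCommGroup V] [Module K V]
    {M : Type*} [AddCommGroup M] [Module (ExteriorAlgebra K V) M]
    (gr : ℤ → AddSubgroup M) : Prop :=
  ∃ s : Set M, (∀ x ∈ s, ∃ k, x ∈ gr k) ∧
    LinearIndependent (ExteriorAlgebra K V) ((↑) : s → M) ∧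
    Submodule.span (ExteriorAlgebra K V) s = ⊤

/-- The submodule `(e_1, …, e_n) M`. -/
def maxIdealSMul (K V : Type*) [Field K] [AddCommGroup V] [Module K V]
    (M : Type*) [AddCommGroup M] [Module (ExteriorAlgebra K V) M] :
    Submodule (ExteriorAlgebra K V) M :=
  Submodule.span (ExteriorAlgebra K V) {y | ∃ (v : V) (x : M), y = ExteriorAlgebra.ι K v • x}

/-- `⋯ → X 2 → X 1 → X 0 → E/I → 0`, with maps `d i : X (i+1) → X i` and `aug : X 0 → E/I`, is a
minimal graded free resolution of `E/I`. -/
structure IsMinimalGradedFreeResolution (I : Ideal (ExteriorAlgebra K V)) {X : ℕ → Type*}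
    [∀ i, AddCommGroup (X i)] [∀ i, Module (ExteriorAlgebra K V) (X i)]
    (gr : ∀ i, ℤ → AddSubgroup (X i))
    (d : ∀ i, X (i + 1) →ₗ[ExteriorAlgebra K V] X i)
    (aug : X 0 →ₗ[ExteriorAlgebra K V] ExteriorAlgebra K V ⧸ I) : Prop where
  graded : ∀ i, IsGradedModule (K := K) (V := V) (gr i)
  free : ∀ i, IsGradedFree K V (gr i)
  d_homogeneous : ∀ i k, ∀ x ∈ gr (i + 1) k, d i x ∈ gr i k
  aug_homogeneous : ∀ k, ∀ x ∈ gr 0 k, aug x ∈ quotDegPart I k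
  aug_surjective : Function.Surjective aug
  exact_zero : LinearMap.range (d 0) = LinearMap.ker aug
  exact_succ : ∀ i, LinearMap.range (d (i + 1)) = LinearMap.ker (d i)
  minimal : ∀ i, LinearMap.range (d i) ≤ maxIdealSMul K V (X i)

end Resolutions

/-! ### The symbols `f(a; u)` and the explicit differentials -/

section Explicit

variable {K V : Type*} [Field K] [AddCommGroup V] [Module K V] {n r : ℕ}

/-- The condition `|a| = i` and `supp(a) ⊆ set(u_j)`. -/
def Admissible (e : Module.Basis (Fin n) K V) (u : Fin r → Finset (Fin n)) (i : ℕ)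
    (a : Fin n → ℕ) (j : Fin r) : Prop :=
  ∑ k, a k = i ∧ ∀ k, a k ≠ 0 → k ∈ quotSet e u j

/-- The index set of the basis `f(a; u_j)` in homological degree `i + 1`: the pairs `(a, j)` with
`|a| = i` and `supp(a) ⊆ set(u_j)`. -/
abbrev Idx (e : Module.Basis (Fin n) K V) (u : Fin r → Finset (Fin n)) (i : ℕ) : Type :=
  {p : (Fin n → ℕ) × Fin r // Admissible e u i p.1 p.2}

/-- The extended symbol `f(a; u_j)`: it is the given element if `(a, j)` is an index, and `0` if
`supp(a) ⊄ set(u_j)`. -/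
def symb (e : Module.Basis (Fin n) K V) (u : Fin r → Finset (Fin n)) {N : Type*} [AddCommGroup N]
    {i : ℕ} (f : Idx e u i → N) (a : Fin n → ℕ) (j : Fin r) : N :=
  if h : Admissible e u i a j then f ⟨(a, j), h⟩ else 0

/-- The element `(-1)^{deg u_j} u_j`. -/
def diffZero (e : Module.Basis (Fin n) K V) (u : Fin r → Finset (Fin n)) (j : Fin r) :
    ExteriorAlgebra K V :=
  (-1) ^ (u j).card * mono e (u j)

/-- For `a ≠ 0` and `u = u_j`, the element
`-∑_{t ∈ supp a} (-1)^{deg u} e_t f(a - ε_t; u)`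
`+ ∑_{t ∈ supp a \ supp u} (-1)^{deg g(e_t u)} (e_t u / g(e_t u)) f(a - ε_t; g(e_t u))`,
where `f` are the symbols in homological degree one less. -/
def diffSucc (e : Module.Basis (Fin n) K V) (u : Fin r → Finset (Fin n)) {N : Type*}
    [AddCommGroup N] [Module (ExteriorAlgebra K V) N] {i : ℕ} (f : Idx e u i → N)
    (a : Fin n → ℕ) (j : Fin r) : N :=
  -(∑ t with a t ≠ 0,
      ((-1 : ExteriorAlgebra K V) ^ (u j).card * gen e t) • symb e u f (a - Pi.single t 1) j)
  + ∑ t with a t ≠ 0 ∧ t ∉ u j,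
      ((-1 : ExteriorAlgebra K V) ^ (u (next e u t j)).card *
          monQuot e (gen e t * mono e (u j)) (mono e (u (next e u t j)))) •
        symb e u f (a - Pi.single t 1) (next e u t j)

/-- The index set of the basis of `F_i`: one element for `F_0 = E`, and the `f(a; u_j)` with
`|a| = i - 1`, `supp(a) ⊆ set(u_j)`, for `i > 0`. -/
def FIdx (e : Module.Basis (Fin n) K V) (u : Fin r → Finset (Fin n)) : ℕ → Type
  | 0 => Unit
  | i + 1 => Idx e u i

/-- The degrees of the basis elements: `0` in `F_0`, and `deg f(a; u_j) = |a| + deg u_j`. -/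
def fdeg (e : Module.Basis (Fin n) K V) (u : Fin r → Finset (Fin n)) :
    ∀ i, FIdx e u i → ℤ
  | 0, _ => 0
  | _ + 1, p => ((∑ k, p.1.1 k : ℕ) : ℤ) + ((u p.1.2).card : ℤ)

/-- The free `E`-module `F_i`. -/
abbrev FMod (e : Module.Basis (Fin n) K V) (u : Fin r → Finset (Fin n)) (i : ℕ) : Type _ :=
  FIdx e u i →₀ ExteriorAlgebra K V

/-- The grading of `F_i`: an element is homogeneous of degree `k` if its coordinate at each basis
element `p` is homogeneous of degree `k - deg p`. -/
def Fgr (e : Module.Basis (Fin n) K V) (u : Fin r → Finset (Fin n)) (i : ℕ) (k : ℤ) :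
    AddSubgroup (FMod e u i) :=
  ⨅ p : FIdx e u i, (degPart K V (k - fdeg e u i p)).comap (Finsupp.applyAddHom p)

/-- The basis element `f(a; u_j)` of `F_{i+1}`. -/
def fbasis (e : Module.Basis (Fin n) K V) (u : Fin r → Finset (Fin n)) (i : ℕ) (p : Idx e u i) :
    FMod e u (i + 1) :=
  Finsupp.single (show FIdx e u (i + 1) from p) 1

/-- The basis element `1` of `F_0 = E`. -/
def fone (e : Module.Basis (Fin n) K V) (u : Fin r → Finset (Fin n)) : FMod e u 0 :=
  Finsupp.single (show FIdx e u 0 from ()) 1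

/-- The `E`-linear maps `F_{i+1} → F_i` given on the basis by the explicit formulas. -/
def Fd (e : Module.Basis (Fin n) K V) (u : Fin r → Finset (Fin n)) :
    ∀ i, FMod e u (i + 1) →ₗ[ExteriorAlgebra K V] FMod e u i
  | 0 => Finsupp.linearCombination (ExteriorAlgebra K V)
      fun p : Idx e u 0 => diffZero e u p.1.2 • fone e u
  | i + 1 => Finsupp.linearCombination (ExteriorAlgebra K V)
      fun p : Idx e u (i + 1) => diffSucc e u (fbasis e u i) p.1.1 p.1.2

/-- The canonical map `F_0 = E → E/I`. -/
def Faug (e : Module.Basis (Fin n) K V) (u : Fin r → Finset (Fin n))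
    (I : Ideal (ExteriorAlgebra K V)) :
    FMod e u 0 →ₗ[ExteriorAlgebra K V] ExteriorAlgebra K V ⧸ I :=
  Finsupp.linearCombination (ExteriorAlgebra K V) fun _ => Submodule.mkQ I 1

end Explicit

end

end ExtRes

open ExtRes

open ExtRes

namespace ExtRes

open scoped Classical

noncomputable section

/-! ### Monomial coordinates, products and ideals in the exterior algebra. -/

section Exterior

variable {K V : Type*} [Field K] [AddCommGroup V] [Module K V] {n : ℕ}

/-! Everything is read off supports. An index `k` lies in set(u_j) exactly when it divides u_j or an
earlier generator divides e_k u_j (`mem_quotSet`). Linear quotients say that if u_j divides e_μ but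
an earlier generator does too, then μ∖u_j meets set(u_j) (`exists_mem_quotSet`). With regularity
this makes the decomposition function associative enough: g(e_s g(e_t u)) = g(e_s e_t u) whenever s
lies in set(g(e_t u)) but not in its support (`isLeast_of_mem`). Then d²f(a;u) is a double sum over
pairs (t,s) whose terms cancel under swapping t and s (`restTerm_add_restTerm`, `Fd_comp_Fd_succ`).

For exactness, a monomial e_μ f(a;u) is matched when the largest element of set(u) occurring in μ or
a occurs in μ. Moving that element from μ to a shows, by induction on the index of u, that image and
unmatched monomials together span (`range_sup_unmatched`). Conversely d is injective on the span U
of unmatched monomials (`eq_zero_of_Fd_succ_eq_zero`, `eq_zero_of_Fd_zero_eq_zero`): at the last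
generator that occurs, only the part of d that keeps the generator is visible, and the same move
recovers each coefficient. So a cycle is a boundary plus an element of U that is itself a cycle,
hence zero.

The complex is minimal because no coefficient of d is a nonzero constant. For uniqueness,
homogeneous lifts of the basis elements give maps from F_i to any other minimal resolution X_i,
built inductively; Nakayama for the nilpotent ideal (e_1,…,e_n) makes each an isomorphism
(`bijective_of_minimal_covers`), and the images of the f(a;u) form the required bases. -/

theorem basis_eq_mono (e : Module.Basis (Fin n) K V) (μ : Finset (Fin n)) :
    e.ExteriorAlgebra μ = mono e μ := by
  rw [ExteriorAlgebra.basis_apply_ofCard e (rfl : μ.card = μ.card),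
    ExteriorAlgebra.ιMulti_family, ExteriorAlgebra.ιMulti_apply, mono,
    ← Finset.listMap_orderEmbOfFin_finRange μ (rfl : μ.card = μ.card), List.ofFn_eq_map,
    List.map_map]
  rfl

/-- The coordinate of an element of the exterior algebra at the monomial `e_μ`. -/
def coef (e : Module.Basis (Fin n) K V) (μ : Finset (Fin n)) : ExteriorAlgebra K V →ₗ[K] K :=
  e.ExteriorAlgebra.coord μ

theorem coef_mono (e : Module.Basis (Fin n) K V) (μ ν : Finset (Fin n)) :
    coef e μ (mono e ν) = if ν = μ then 1 else 0 := by
  rw [← basis_eq_mono, coef, Module.Basis.coord_apply, Module.Basis.repr_self,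
    Finsupp.single_apply]

theorem ext_coef (e : Module.Basis (Fin n) K V) {x y : ExteriorAlgebra K V}
    (h : ∀ μ, coef e μ x = coef e μ y) : x = y :=
  e.ExteriorAlgebra.ext_elem h

theorem sum_coef (e : Module.Basis (Fin n) K V) (x : ExteriorAlgebra K V) :
    ∑ μ, coef e μ x • mono e μ = x := by
  simp_rw [← basis_eq_mono]
  exact e.ExteriorAlgebra.sum_repr x

theorem mono_mul_of_not_disjoint (e : Module.Basis (Fin n) K V) {μ ν : Finset (Fin n)}
    (h : ¬ Disjoint μ ν) : mono e μ * mono e ν = 0 := by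
  simp_rw [← basis_eq_mono]
  exact ExteriorAlgebra.basis_mul_of_not_disjoint e ⟨μ, rfl⟩ ⟨ν, rfl⟩ h

theorem mono_mul_of_disjoint (e : Module.Basis (Fin n) K V) {μ ν : Finset (Fin n)}
    (h : Disjoint μ ν) :
    mono e μ * mono e ν = mono e (μ ∪ ν) ∨ mono e μ * mono e ν = -mono e (μ ∪ ν) := by
  simp_rw [← basis_eq_mono]
  have := ExteriorAlgebra.basis_mul_of_disjoint e (⟨μ, rfl⟩ : Set.powersetCard (Fin n) μ.card)
    ⟨ν, rfl⟩ h
  rw [this, Set.powersetCard.coe_disjUnion, Finset.disjUnion_eq_union]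
  rcases Int.units_eq_one_or (Set.powersetCard.permOfDisjoint
    (s := (⟨μ, rfl⟩ : Set.powersetCard (Fin n) μ.card)) (t := ⟨ν, rfl⟩) h).sign with h | h <;>
    simp [h]

/-- The sign of the product of two monomials, `0` if the product vanishes. -/
def sgn (e : Module.Basis (Fin n) K V) (μ ν : Finset (Fin n)) : K :=
  coef e (μ ∪ ν) (mono e μ * mono e ν)

theorem mono_mul_mono (e : Module.Basis (Fin n) K V) (μ ν : Finset (Fin n)) :
    mono e μ * mono e ν = sgn e μ ν • mono e (μ ∪ ν) := by
  by_cases h : Disjoint μ ν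
  · rcases mono_mul_of_disjoint e h with h | h <;> simp [sgn, h, coef_mono]
  · simp [sgn, mono_mul_of_not_disjoint e h]

theorem sgn_eq_zero (e : Module.Basis (Fin n) K V) {μ ν : Finset (Fin n)} (h : ¬ Disjoint μ ν) :
    sgn e μ ν = 0 := by
  simp [sgn, mono_mul_of_not_disjoint e h]

theorem sgn_eq_or (e : Module.Basis (Fin n) K V) {μ ν : Finset (Fin n)} (h : Disjoint μ ν) :
    sgn e μ ν = 1 ∨ sgn e μ ν = -1 := by
  rcases mono_mul_of_disjoint e h with h | h <;> simp [sgn, h, coef_mono]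

theorem sgn_ne_zero (e : Module.Basis (Fin n) K V) {μ ν : Finset (Fin n)} (h : Disjoint μ ν) :
    sgn e μ ν ≠ 0 := by
  rcases sgn_eq_or e h with h | h <;> simp [h]

theorem mono_empty (e : Module.Basis (Fin n) K V) : mono e ∅ = 1 := by
  simp [mono]

theorem mono_singleton (e : Module.Basis (Fin n) K V) (t : Fin n) : mono e {t} = gen e t := by
  simp [mono]

theorem coef_mul_mono (e : Module.Basis (Fin n) K V) (x : ExteriorAlgebra K V)
    (τ ν : Finset (Fin n)) :
    coef e ν (x * mono e τ) = if τ ⊆ ν then sgn e (ν \ τ) τ * coef e (ν \ τ) x else 0 := by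
  conv_lhs => rw [← sum_coef e x]
  simp_rw [Finset.sum_mul, map_sum, smul_mul_assoc, mono_mul_mono, map_smul, coef_mono, smul_eq_mul]
  split_ifs with h
  · rw [Finset.sum_eq_single (ν \ τ)]
    · rw [if_pos (Finset.sdiff_union_of_subset h)]; ring
    · intro b _ hb
      by_cases hd : Disjoint b τ
      · rw [if_neg]
        · simp
        · rintro rfl
          exact hb (by rw [Finset.union_sdiff_right, Finset.sdiff_eq_self_of_disjoint hd])
      · simp [sgn_eq_zero e hd]
    · simp
  · refine Finset.sum_eq_zero fun b _ => ?_
    rw [if_neg]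
    · simp
    · rintro rfl
      exact h Finset.subset_union_right

/-- Left multiplication only enlarges supports, and conversely a monomial divisible by a generator
is an invertible scalar times a left multiple of it. Ideal membership thus becomes inclusion of
finite sets. -/
theorem mem_span_mono (e : Module.Basis (Fin n) K V) (A : Set (Finset (Fin n)))
    (x : ExteriorAlgebra K V) :
    x ∈ Ideal.span (mono e '' A) ↔ ∀ μ, coef e μ x ≠ 0 → ∃ ν ∈ A, ν ⊆ μ := by
  constructor
  · intro hx
    induction hx using Submodule.span_induction with
    | mem y hy =>
      obtain ⟨ν, hν, rfl⟩ := hy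
      intro μ h
      rw [coef_mono] at h
      exact ⟨ν, hν, by simp_all⟩
    | zero => simp
    | add y z _ _ hy hz =>
      intro μ h
      by_contra hc
      have h1 := not_imp_not.2 (hy μ) hc
      have h2 := not_imp_not.2 (hz μ) hc
      push Not at h1 h2
      simp [h1, h2] at h
    | smul a y _ hy =>
      intro μ h
      rw [smul_eq_mul, ← sum_coef e y, Finset.mul_sum, map_sum] at h
      obtain ⟨τ, -, hτ⟩ := Finset.exists_ne_zero_of_sum_ne_zero h
      rw [mul_smul_comm, map_smul, coef_mul_mono, smul_eq_mul] at hτ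
      obtain ⟨ν, hν, h1⟩ := hy τ (left_ne_zero_of_mul hτ)
      have : τ ⊆ μ := by
        by_contra hc
        simp [hc] at hτ
      exact ⟨ν, hν, h1.trans this⟩
  · intro h
    rw [← sum_coef e x]
    refine Submodule.sum_mem _ fun μ _ => ?_
    by_cases hc : coef e μ x = 0
    · simp [hc]
    obtain ⟨ν, hν, h1⟩ := h μ hc
    have hd : Disjoint (μ \ ν) ν := Finset.sdiff_disjoint
    have : mono e μ = ((sgn e (μ \ ν) ν)⁻¹ • mono e (μ \ ν)) * mono e ν := by
      rw [smul_mul_assoc, mono_mul_mono, smul_smul, inv_mul_cancel₀ (sgn_ne_zero e hd), one_smul,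
        Finset.sdiff_union_of_subset h1]
    rw [this, ← smul_mul_assoc]
    exact Ideal.mul_mem_left _ _ (Ideal.subset_span ⟨ν, hν, rfl⟩)

theorem mono_mem_span_mono (e : Module.Basis (Fin n) K V) (A : Set (Finset (Fin n)))
    (μ : Finset (Fin n)) : mono e μ ∈ Ideal.span (mono e '' A) ↔ ∃ ν ∈ A, ν ⊆ μ := by
  simp [mem_span_mono, coef_mono]

theorem mem_span_gen (e : Module.Basis (Fin n) K V) (A : Set (Fin n)) (x : ExteriorAlgebra K V) :
    x ∈ Ideal.span (gen e '' A) ↔ ∀ μ, coef e μ x ≠ 0 → ∃ k ∈ A, k ∈ μ := by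
  have : gen e '' A = mono e '' ((fun k => {k}) '' A) := by
    rw [Set.image_image]
    simp_rw [mono_singleton]
  rw [this, mem_span_mono]
  simp

theorem gen_mul_mono (e : Module.Basis (Fin n) K V) (t : Fin n) (μ : Finset (Fin n)) :
    gen e t * mono e μ = sgn e {t} μ • mono e (insert t μ) := by
  rw [← mono_singleton, mono_mul_mono]
  rfl

theorem gen_mul_mono_of_mem (e : Module.Basis (Fin n) K V) {t : Fin n} {μ : Finset (Fin n)}
    (h : t ∈ μ) : gen e t * mono e μ = 0 := by
  rw [gen_mul_mono, sgn_eq_zero e (by simpa using h), zero_smul]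

theorem coef_mul_gen (e : Module.Basis (Fin n) K V) (x : ExteriorAlgebra K V)
    (t : Fin n) (ν : Finset (Fin n)) :
    coef e ν (x * gen e t) = if t ∈ ν then sgn e (ν.erase t) {t} * coef e (ν.erase t) x else 0 := by
  rw [← mono_singleton, coef_mul_mono, Finset.sdiff_singleton_eq_erase]
  simp

theorem gen_mul_gen_swap (e : Module.Basis (Fin n) K V) (s t : Fin n) :
    gen e s * gen e t = -(gen e t * gen e s) :=
  eq_neg_of_add_eq_zero_left (ExteriorAlgebra.ι_add_mul_swap _ _)

theorem gen_mul_self (e : Module.Basis (Fin n) K V) (t : Fin n) : gen e t * gen e t = 0 :=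
  ExteriorAlgebra.ι_sq_zero _

theorem mono_mul_gen_comm (e : Module.Basis (Fin n) K V) (t : Fin n) (μ : Finset (Fin n)) :
    mono e μ * gen e t = (-1) ^ μ.card * (gen e t * mono e μ) := by
  have key : ∀ l : List (Fin n), (l.map (gen e)).prod * gen e t
      = (-1) ^ l.length * (gen e t * (l.map (gen e)).prod) := by
    intro l
    induction l with
    | nil => simp
    | cons a l ih =>
      rw [List.map_cons, List.prod_cons, mul_assoc, ih, List.length_cons, pow_succ,
        ((Commute.neg_one_left (gen e a)).pow_left l.length).symm.left_comm]
      rw [← mul_assoc (gen e a), gen_mul_gen_swap e a t]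
      simp [mul_assoc]
  have := key (μ.sort (· ≤ ·))
  rwa [Finset.length_sort] at this

theorem mono_mem_exteriorPower (e : Module.Basis (Fin n) K V) (μ : Finset (Fin n)) :
    mono e μ ∈ ⋀[K]^μ.card V := by
  rw [← basis_eq_mono, ExteriorAlgebra.basis_apply_ofCard e (rfl : μ.card = μ.card)]
  exact ExteriorAlgebra.ιMulti_range K _ ⟨_, rfl⟩

/-- If `ν ⊆ insert t μ` and `t ∉ μ`, then `e_t e_μ / e_ν` is `± e_σ` with `σ = insert t μ \ ν`,
and its product with `e_ν` is `e_t e_μ`. -/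
theorem monQuot_spec (e : Module.Basis (Fin n) K V) {t : Fin n} {μ ν : Finset (Fin n)}
    (ht : t ∉ μ) (hν : ν ⊆ insert t μ) :
    monQuot e (gen e t * mono e μ) (mono e ν) * mono e ν = gen e t * mono e μ ∧
      (monQuot e (gen e t * mono e μ) (mono e ν) = mono e (insert t μ \ ν) ∨
        monQuot e (gen e t * mono e μ) (mono e ν) = -mono e (insert t μ \ ν)) := by
  have hex : ∃ w, IsMonomial e w ∧ w * mono e ν = gen e t * mono e μ := by
    have h1 := mono_mul_mono e (insert t μ \ ν) ν
    rw [Finset.sdiff_union_of_subset hν] at h1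
    rw [gen_mul_mono]
    rcases sgn_eq_or e (Finset.sdiff_disjoint : Disjoint (insert t μ \ ν) ν) with h2 | h2 <;>
    rcases sgn_eq_or e (Finset.disjoint_singleton_left.2 ht) with h3 | h3
    · exact ⟨_, ⟨_, Or.inl rfl⟩, by rw [h1, h2, h3]⟩
    · exact ⟨_, ⟨_, Or.inr rfl⟩, by rw [neg_mul, h1, h2, h3]; simp⟩
    · exact ⟨_, ⟨_, Or.inr rfl⟩, by rw [neg_mul, h1, h2, h3]; simp⟩
    · exact ⟨_, ⟨_, Or.inl rfl⟩, by rw [h1, h2, h3]⟩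
  rw [monQuot, dif_pos hex]
  obtain ⟨⟨σ, hσ⟩, hw⟩ := hex.choose_spec
  refine ⟨hw, ?_⟩
  -- The chosen quotient is only known to be some ±e_σ; comparing the coefficients of e_t e_μ forces
  -- σ.
  have hne : coef e (insert t μ) (mono e σ * mono e ν) ≠ 0 := by
    have h3 : coef e (insert t μ) (gen e t * mono e μ) ≠ 0 := by
      rw [gen_mul_mono, map_smul, coef_mono, if_pos rfl, smul_eq_mul, mul_one]
      exact sgn_ne_zero e (Finset.disjoint_singleton_left.2 ht)
    rw [← hw] at h3
    rcases hσ with h | h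
    · rwa [h] at h3
    · rw [h, neg_mul, map_neg] at h3
      exact neg_ne_zero.1 h3
  rw [coef_mul_mono, if_pos hν, coef_mono] at hne
  have : σ = insert t μ \ ν := by
    by_contra hc
    simp [hc] at hne
  rwa [this] at hσ

/-- Right multiplication by `e_ν` is injective on elements all of whose monomials are disjoint
from `ν`. -/
theorem eq_zero_of_mul_mono_eq_zero (e : Module.Basis (Fin n) K V) {x : ExteriorAlgebra K V}
    {ν : Finset (Fin n)} (hx : ∀ μ, coef e μ x ≠ 0 → Disjoint μ ν) (h : x * mono e ν = 0) :
    x = 0 := by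
  refine ext_coef e fun μ => ?_
  rw [map_zero]
  by_contra hc
  have hd := hx μ hc
  have h1 := congrArg (coef e (μ ∪ ν)) h
  rw [coef_mul_mono, if_pos Finset.subset_union_right, Finset.union_sdiff_right,
    Finset.sdiff_eq_self_of_disjoint hd, map_zero] at h1
  exact mul_ne_zero (sgn_ne_zero e hd) hc h1

end Exterior

/-! ### Divisibility, the sets set(u_j) and the decomposition function. -/

section Combinatorics

variable {K V : Type*} [Field K] [AddCommGroup V] [Module K V] {n r : ℕ}
  {e : Module.Basis (Fin n) K V} {u : Fin r → Finset (Fin n)}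

theorem mem_colon {J : Ideal (ExteriorAlgebra K V)} {m x : ExteriorAlgebra K V} :
    x ∈ colon J m ↔ x * m ∈ J := Iff.rfl

theorem idealLT_eq (e : Module.Basis (Fin n) K V) (u : Fin r → Finset (Fin n)) (j : Fin r) :
    idealLT e u j = Ideal.span (mono e '' (u '' {i | i < j})) := by
  rw [idealLT, Set.image_image]

theorem idealLE_eq (e : Module.Basis (Fin n) K V) (u : Fin r → Finset (Fin n)) (j : Fin r) :
    idealLE e u j = Ideal.span (mono e '' (u '' {i | i ≤ j})) := by
  rw [idealLE, Set.image_image]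

/-- For `k` in the support the product e_k u_j is zero, hence in every ideal; otherwise it is ± a
monomial, and membership in a monomial ideal is divisibility by a generator. -/
theorem mem_quotSet {j : Fin r} {k : Fin n} :
    k ∈ quotSet e u j ↔ k ∈ u j ∨ ∃ i < j, u i ⊆ insert k (u j) := by
  change gen e k * mono e (u j) ∈ idealLT e u j ↔ _
  rw [idealLT_eq]
  by_cases hk : k ∈ u j
  · simp [hk, gen_mul_mono_of_mem]
  · have h0 := sgn_ne_zero e (Finset.disjoint_singleton_left.2 hk)
    rw [mem_span_mono]
    simp only [gen_mul_mono, map_smul, coef_mono, smul_eq_mul, hk, false_or]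
    simp [h0]

theorem mem_quotSet_of_mem {j : Fin r} {k : Fin n} (h : k ∈ u j) : k ∈ quotSet e u j :=
  mem_quotSet.2 (Or.inl h)

theorem next_isLeast {j : Fin r} {t : Fin n} (ht : t ∉ u j) :
    IsLeast {i | u i ⊆ insert t (u j)} (next e u t j) := by
  have h0 := sgn_ne_zero e (Finset.disjoint_singleton_left.2 ht)
  have key : ∀ i, gen e t * mono e (u j) ∈ idealLE e u i ↔ ∃ k ≤ i, u k ⊆ insert t (u j) := by
    intro i
    rw [idealLE_eq, mem_span_mono]
    simp only [gen_mul_mono, map_smul, coef_mono, smul_eq_mul]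
    simp [h0]
  -- The index `j` itself qualifies, so the default value of `decomp` never occurs here.
  have hne : (Finset.univ.filter fun i => gen e t * mono e (u j) ∈ idealLE e u i).Nonempty :=
    ⟨j, by simpa [key] using ⟨j, le_rfl, Finset.subset_insert _ _⟩⟩
  have hdef : next e u t j = (Finset.univ.filter fun i =>
      gen e t * mono e (u j) ∈ idealLE e u i).min' hne := by
    rw [next, decomp, dif_pos hne]
  constructor
  · have := Finset.min'_mem _ hne
    rw [← hdef, Finset.mem_filter, key] at this
    obtain ⟨-, k, hk, h1⟩ := this
    have h2 : next e u t j ≤ k := by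
      rw [hdef]
      exact Finset.min'_le _ _ (by simpa [key] using ⟨k, le_rfl, h1⟩)
    rwa [le_antisymm hk h2] at h1
  · intro i hi
    rw [hdef]
    exact Finset.min'_le _ _ (by simpa [key] using ⟨i, le_rfl, hi⟩)

theorem next_subset {j : Fin r} {t : Fin n} (ht : t ∉ u j) :
    u (next e u t j) ⊆ insert t (u j) :=
  (next_isLeast ht).1

theorem next_lt {j : Fin r} {t : Fin n} (htS : t ∈ quotSet e u j) (ht : t ∉ u j) :
    next e u t j < j := by
  obtain h | ⟨i, hi, h⟩ := mem_quotSet.1 htS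
  · exact absurd h ht
  · exact ((next_isLeast ht).2 h).trans_lt hi

/-- Were `t` missing, g(e_t u_j) would divide u_j, hence equal it because no generator divides
another; but its index is strictly smaller. -/
theorem mem_next (hanti : ∀ i j, u i ⊆ u j → i = j) {j : Fin r} {t : Fin n}
    (htS : t ∈ quotSet e u j) (ht : t ∉ u j) : t ∈ u (next e u t j) := by
  by_contra hc
  exact (next_lt htS ht).ne
    (hanti _ _ ((Finset.subset_insert_iff_of_notMem hc).1 (next_subset ht)))

/-- The quotient `e_t u_j / g(e_t u_j)` involves no variable of `set(g(e_t u_j))`. -/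
theorem notMem_quotSet_next {j : Fin r} {t k : Fin n} (ht : t ∉ u j)
    (hk : k ∈ insert t (u j)) (hkg : k ∉ u (next e u t j)) :
    k ∉ quotSet e u (next e u t j) := by
  intro h
  obtain h | ⟨i, hi, h⟩ := mem_quotSet.1 h
  · exact hkg h
  -- Adjoining `k` to g(e_t u_j) stays inside e_t u_j, so an earlier divisor would contradict
  -- minimality of the index.
  · exact hi.not_ge ((next_isLeast ht).2 (h.trans (Finset.insert_subset hk (next_subset ht))))

theorem exists_mem_quotSet_of_mem_colon (hlin : HasLinearQuotients e u) {j : Fin r}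
    {x : ExteriorAlgebra K V} (hx : x ∈ colon (idealLT e u j) (mono e (u j)))
    {μ : Finset (Fin n)} (hμ : coef e μ x ≠ 0) : ∃ k ∈ μ, k ∈ quotSet e u j := by
  obtain ⟨A, hA⟩ := hlin j
  rw [hA, mem_span_gen] at hx
  obtain ⟨k, hk, hkμ⟩ := hx μ hμ
  refine ⟨k, hkμ, ?_⟩
  change gen e k ∈ colon (idealLT e u j) (mono e (u j))
  rw [hA]
  exact Ideal.subset_span ⟨k, hk, rfl⟩

/-- The monomial e_{μ∖u_j} lies in the colon ideal, which is generated by variables, so one of them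
divides it. In contrapositive form this certifies that u_j is the first generator dividing e_μ. -/
theorem exists_mem_quotSet (hlin : HasLinearQuotients e u) {i j : Fin r} (hij : i < j)
    {μ : Finset (Fin n)} (hμ : u i ⊆ μ) (hj : u j ⊆ μ) : ∃ k ∈ μ, k ∉ u j ∧ k ∈ quotSet e u j := by
  have hx : mono e (μ \ u j) ∈ colon (idealLT e u j) (mono e (u j)) := by
    rw [mem_colon, mono_mul_mono, Finset.sdiff_union_of_subset hj, idealLT_eq]
    refine Submodule.smul_of_tower_mem _ _ ?_
    rw [mono_mem_span_mono]
    exact ⟨u i, ⟨i, hij, rfl⟩, hμ⟩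
  obtain ⟨k, hk, h⟩ := exists_mem_quotSet_of_mem_colon hlin hx
    (μ := μ \ u j) (by simp [coef_mono])
  rw [Finset.mem_sdiff] at hk
  exact ⟨k, hk.1, hk.2, h⟩

/-- If `s ∉ set(g(e_t u_j))`, then `g(e_s e_t u_j) = g(e_t u_j)`. -/
theorem isLeast_of_notMem (hlin : HasLinearQuotients e u) {j : Fin r} {s t : Fin n}
    (ht : t ∉ u j) (hs : s ∉ quotSet e u (next e u t j)) :
    IsLeast {i | u i ⊆ insert s (insert t (u j))} (next e u t j) := by
  refine ⟨(next_subset ht).trans (Finset.subset_insert _ _), fun i hi => ?_⟩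
  by_contra hlt
  obtain ⟨k, hk, hk1, hk2⟩ := exists_mem_quotSet hlin (not_le.1 hlt) hi
    ((next_subset ht).trans (Finset.subset_insert _ _))
  rw [Finset.mem_insert] at hk
  rcases hk with rfl | hk
  · exact hs hk2
  · exact notMem_quotSet_next ht hk hk1 hk2

/-- If `s ∈ set(g(e_t u_j))`, then `g(e_s e_t u_j) = g(e_s g(e_t u_j))`. -/
theorem isLeast_of_mem (hlin : HasLinearQuotients e u) (hreg : IsRegularDecomp e u) {j : Fin r}
    {s t : Fin n} (ht : t ∉ u j) (hsS : s ∈ quotSet e u (next e u t j))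
    (hs : s ∉ u (next e u t j)) :
    IsLeast {i | u i ⊆ insert s (insert t (u j))} (next e u s (next e u t j)) := by
  have h1 : u (next e u s (next e u t j)) ⊆ insert s (insert t (u j)) :=
    (next_subset hs).trans (Finset.insert_subset_insert _ (next_subset ht))
  refine ⟨h1, fun i hi => ?_⟩
  by_contra hlt
  obtain ⟨k, hk, hk1, hk2⟩ := exists_mem_quotSet hlin (not_le.1 hlt) hi h1
  by_cases hkg : k ∈ insert s (u (next e u t j))
  · exact notMem_quotSet_next hs hkg hk1 hk2
  · rw [Finset.mem_insert, not_or] at hkg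
    have hk' : k ∈ insert t (u j) := (Finset.mem_insert.1 hk).resolve_left hkg.1
    -- Regularity carries `k` back into set(g(e_t u_j)), where no variable of the quotient e_t u_j /
    -- g(e_t u_j) can lie.
    exact notMem_quotSet_next ht hk' hkg.2 (hreg _ s hsS hs hk2)

theorem antichain_of_enumerates {I : Ideal (ExteriorAlgebra K V)} (hu : EnumeratesMinGens e I u)
    (i j : Fin r) (h : u i ⊆ u j) : i = j := by
  refine hu.1 (by_contra fun hne => ?_)
  have hi : u i ∈ minGens e I := hu.2 ▸ ⟨i, rfl⟩
  have hj : u j ∈ minGens e I := hu.2 ▸ ⟨j, rfl⟩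
  exact hj.2 _ (Finset.ssubset_iff_subset_ne.2 ⟨h, hne⟩) hi.1

/-- Each monomial of I has a minimal divisor in I, because supports are finite. -/
theorem eq_span_of_enumerates {I : Ideal (ExteriorAlgebra K V)} (hI : IsMonomialIdeal e I)
    (hu : EnumeratesMinGens e I u) : I = Ideal.span (mono e '' Set.range u) := by
  obtain ⟨A, hA⟩ := hI
  apply le_antisymm
  · rw [hA, Ideal.span_le]
    rintro _ ⟨μ, hμ, rfl⟩
    change mono e μ ∈ Ideal.span _
    have hμI : mono e μ ∈ I := hA ▸ Ideal.subset_span ⟨μ, hμ, rfl⟩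
    obtain ⟨ν, hν, hmin⟩ := exists_minimal_le_of_wellFoundedLT (fun ν => mono e ν ∈ I) μ hμI
    rw [mono_mem_span_mono, hu.2]
    exact ⟨ν, ⟨hmin.1, fun τ hτ h => hτ.not_subset (hmin.2 h hτ.subset)⟩, hν⟩
  · rw [Ideal.span_le]
    rintro _ ⟨_, ⟨j, rfl⟩, rfl⟩
    have hj : u j ∈ minGens e I := hu.2 ▸ ⟨j, rfl⟩
    exact hj.1

theorem nonempty_of_enumerates {I : Ideal (ExteriorAlgebra K V)} (hproper : I ≠ ⊤)
    (hu : EnumeratesMinGens e I u) (j : Fin r) : (u j).Nonempty := by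
  rw [Finset.nonempty_iff_ne_empty]
  intro h
  have hj : u j ∈ minGens e I := hu.2 ▸ ⟨j, rfl⟩
  rw [h] at hj
  exact hproper ((Ideal.eq_top_iff_one _).2 (mono_empty e ▸ hj.1))

end Combinatorics

/-! ### Coefficient identities behind d² = 0. -/

section SquareZero

variable {K V : Type*} [Field K] [AddCommGroup V] [Module K V] {n r : ℕ}
  {e : Module.Basis (Fin n) K V} {u : Fin r → Finset (Fin n)}

theorem neg_one_pow_mul_eq_smul (k : ℕ) (x : ExteriorAlgebra K V) :
    (-1 : ExteriorAlgebra K V) ^ k * x = ((-1 : K) ^ k) • x := by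
  rcases neg_one_pow_eq_or (ExteriorAlgebra K V) k with h | h <;>
  rcases Nat.even_or_odd k with h' | h' <;> simp [h'.neg_one_pow]

theorem neg_one_pow_smul_smul {M : Type*} [AddCommGroup M] [Module K M] (k : ℕ) (x : M) :
    ((-1 : K) ^ k) • ((-1 : K) ^ k) • x = x := by
  rw [smul_smul, ← mul_pow]
  simp

/-- The coefficient `(-1)^{deg g(e_t u)} e_t u / g(e_t u)` of the second part of the differential,
extended by `0` to `t ∈ supp u`. -/
def quotCoeff (e : Module.Basis (Fin n) K V) (u : Fin r → Finset (Fin n)) (t : Fin n)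
    (j : Fin r) : ExteriorAlgebra K V :=
  if t ∈ u j then 0 else
    ((-1 : K) ^ (u (next e u t j)).card) •
      monQuot e (gen e t * mono e (u j)) (mono e (u (next e u t j)))

theorem quotCoeff_of_mem {t : Fin n} {j : Fin r} (h : t ∈ u j) : quotCoeff e u t j = 0 :=
  if_pos h

theorem quotCoeff_mul_mono {t : Fin n} {j : Fin r} (h : t ∉ u j) :
    quotCoeff e u t j * mono e (u (next e u t j)) =
      ((-1 : K) ^ (u (next e u t j)).card) • (gen e t * mono e (u j)) := by
  rw [quotCoeff, if_neg h, smul_mul_assoc, (monQuot_spec e h (next_subset h)).1]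

theorem quotCoeff_eq {t : Fin n} {j : Fin r} (h : t ∉ u j) :
    ∃ c : K, quotCoeff e u t j = c • mono e (insert t (u j) \ u (next e u t j)) := by
  rw [quotCoeff, if_neg h]
  rcases (monQuot_spec e h (next_subset (e := e) h)).2 with h | h <;> rw [h]
  · exact ⟨(-1) ^ (u (next e u t j)).card, rfl⟩
  · exact ⟨-(-1) ^ (u (next e u t j)).card, by simp⟩

/-- The quotient has degree deg u_j + 1 − deg g(e_t u_j), which has the same parity as the exponent
on the right. -/
theorem quotCoeff_mul_gen (t s : Fin n) (j : Fin r) :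
    quotCoeff e u t j * gen e s =
      ((-1 : K) ^ ((u j).card + (u (next e u t j)).card + 1)) • (gen e s * quotCoeff e u t j) := by
  by_cases h : t ∈ u j
  · simp [quotCoeff_of_mem h]
  obtain ⟨c, hc⟩ := quotCoeff_eq (e := e) h
  have hcard : (insert t (u j) \ u (next e u t j)).card + (u (next e u t j)).card
      = (u j).card + 1 := by
    rw [Finset.card_sdiff_add_card_eq_card (next_subset h), Finset.card_insert_of_notMem h]
  rw [hc, smul_mul_assoc, mul_smul_comm, mono_mul_gen_comm, neg_one_pow_mul_eq_smul,
    smul_comm c, add_right_comm, ← hcard, add_assoc, pow_add, ← two_mul, pow_mul]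
  simp

/-- The second-order coefficient along `t`, then `s`, is the one of the direct route
through `e_s e_t u_j`. -/
theorem quotCoeff_mul_quotCoeff_mul_mono {s t : Fin n} {j : Fin r} (ht : t ∉ u j)
    (hs : s ∉ u (next e u t j)) :
    quotCoeff e u t j * quotCoeff e u s (next e u t j) *
        mono e (u (next e u s (next e u t j))) =
      ((-1 : K) ^ ((u j).card + (u (next e u s (next e u t j))).card)) •
        (gen e t * gen e s * mono e (u j)) := by
  rw [mul_assoc, quotCoeff_mul_mono hs, mul_smul_comm, ← mul_assoc, quotCoeff_mul_gen,
    smul_mul_assoc, mul_assoc, quotCoeff_mul_mono ht, mul_smul_comm, ← mul_assoc,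
    gen_mul_gen_swap e s t]
  simp only [neg_mul, smul_neg, smul_smul, ← pow_add]
  rw [← neg_smul]
  congr 1
  rw [neg_eq_iff_eq_neg, ← mul_neg_one ((-1 : K) ^ _), ← pow_succ]
  exact neg_one_pow_congr (by simp only [Nat.even_add_one, Nat.even_add]; tauto)

/-- All monomials of `x` are disjoint from `ν`. -/
def SupportDisjoint (e : Module.Basis (Fin n) K V) (ν : Finset (Fin n))
    (x : ExteriorAlgebra K V) : Prop :=
  ∀ μ, coef e μ x ≠ 0 → Disjoint μ ν

theorem SupportDisjoint.sub {ν : Finset (Fin n)} {x y : ExteriorAlgebra K V}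
    (hx : SupportDisjoint e ν x) (hy : SupportDisjoint e ν y) : SupportDisjoint e ν (x - y) := by
  intro μ h
  by_contra hc
  have h1 := not_imp_not.2 (hx μ) hc
  have h2 := not_imp_not.2 (hy μ) hc
  push Not at h1 h2
  simp [h1, h2] at h

theorem SupportDisjoint.smul {ν : Finset (Fin n)} {x : ExteriorAlgebra K V} (c : K)
    (hx : SupportDisjoint e ν x) : SupportDisjoint e ν (c • x) := by
  intro μ h
  rw [map_smul] at h
  exact hx μ (right_ne_zero_of_smul h)

theorem supportDisjoint_mono {μ ν : Finset (Fin n)} (h : Disjoint μ ν) :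
    SupportDisjoint e ν (mono e μ) := by
  intro τ hτ
  rw [coef_mono] at hτ
  have : μ = τ := by simp_all
  rwa [← this]

theorem supportDisjoint_mono_mul_mono {μ τ ν : Finset (Fin n)} (h : Disjoint μ ν)
    (h' : Disjoint τ ν) : SupportDisjoint e ν (mono e μ * mono e τ) := by
  rw [mono_mul_mono]
  exact (supportDisjoint_mono (Finset.disjoint_union_left.2 ⟨h, h'⟩)).smul _

theorem supportDisjoint_gen_mul_quotCoeff {s t : Fin n} {j : Fin r} (hs : s ∉ u j)
    (ht : t ∉ u (next e u s j)) :
    SupportDisjoint e (u (next e u s j)) (gen e t * quotCoeff e u s j) := by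
  obtain ⟨c, hc⟩ := quotCoeff_eq (e := e) hs
  rw [hc, mul_smul_comm, ← mono_singleton]
  exact (supportDisjoint_mono_mul_mono (by simpa using ht) Finset.sdiff_disjoint).smul _

theorem supportDisjoint_quotCoeff_mul_quotCoeff {s t : Fin n} {j : Fin r} (ht : t ∉ u j)
    (hs : s ∉ u j) (hst : s ≠ t) (hs' : s ∉ u (next e u t j)) :
    SupportDisjoint e (u (next e u s (next e u t j)))
      (quotCoeff e u t j * quotCoeff e u s (next e u t j)) := by
  obtain ⟨c, hc⟩ := quotCoeff_eq (e := e) ht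
  obtain ⟨c', hc'⟩ := quotCoeff_eq (e := e) hs'
  rw [hc, hc', smul_mul_smul_comm]
  refine (supportDisjoint_mono_mul_mono ?_ Finset.sdiff_disjoint).smul _
  refine Finset.disjoint_of_subset_right (next_subset hs') ?_
  rw [Finset.disjoint_insert_right]
  exact ⟨by simp [hs, hst], Finset.sdiff_disjoint⟩

/-- Multiplied by the common final generator, the two products become e_t e_s u_j and e_s e_t u_j
with equal signs, which cancel. The generator can be removed again since both products are supported
away from it. -/
theorem quotCoeff_mul_quotCoeff_add {s t : Fin n} {j : Fin r} (ht : t ∉ u j)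
    (hs : s ∉ u j) (hst : s ≠ t) (hs' : s ∉ u (next e u t j)) (ht' : t ∉ u (next e u s j))
    (hh : next e u s (next e u t j) = next e u t (next e u s j)) :
    quotCoeff e u t j * quotCoeff e u s (next e u t j) +
      quotCoeff e u s j * quotCoeff e u t (next e u s j) = 0 := by
  rw [← sub_neg_eq_add]
  have hd := supportDisjoint_quotCoeff_mul_quotCoeff ht hs hst hs'
  have hd' := supportDisjoint_quotCoeff_mul_quotCoeff hs ht hst.symm ht'
  rw [← hh] at hd'
  refine eq_zero_of_mul_mono_eq_zero e (hd.sub (by simpa using hd'.smul (-1))) ?_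
  have h2 := quotCoeff_mul_quotCoeff_mul_mono hs ht'
  rw [← hh] at h2
  rw [sub_mul, neg_mul, sub_neg_eq_add, quotCoeff_mul_quotCoeff_mul_mono ht hs', h2,
    gen_mul_gen_swap e t s]
  simp

/-- Here g(e_s u_j) is already the final generator. Both sides times this generator are the same
multiple of e_t e_s u_j, and both are supported away from it. -/
theorem quotCoeff_mul_quotCoeff_sub {s t : Fin n} {j : Fin r} (ht : t ∉ u j)
    (hs : s ∉ u j) (hst : s ≠ t) (hs' : s ∉ u (next e u t j)) (ht' : t ∉ u (next e u s j))
    (hh : next e u s (next e u t j) = next e u s j) :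
    quotCoeff e u t j * quotCoeff e u s (next e u t j) =
      ((-1 : K) ^ (u j).card) • (gen e t * quotCoeff e u s j) := by
  rw [← sub_eq_zero]
  have hd := supportDisjoint_quotCoeff_mul_quotCoeff ht hs hst hs'
  have h2 := quotCoeff_mul_quotCoeff_mul_mono ht hs'
  rw [hh] at hd h2
  refine eq_zero_of_mul_mono_eq_zero e
    (hd.sub ((supportDisjoint_gen_mul_quotCoeff hs ht').smul _)) ?_
  rw [sub_mul, h2, smul_mul_assoc, mul_assoc (gen e t) (quotCoeff e u s j), quotCoeff_mul_mono hs,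
    mul_smul_comm, smul_smul, pow_add, ← mul_assoc (gen e t), sub_self]

section Cancellation

variable {N : Type*} [AddCommGroup N] [Module (ExteriorAlgebra K V) N]

/-- The part of the coefficient of `d² f(a; u_j)` at a pair `(t, s)` that remains after the
immediate cancellations. -/
def restTerm (e : Module.Basis (Fin n) K V) (u : Fin r → Finset (Fin n)) (Y : Fin r → N)
    (j : Fin r) (t s : Fin n) : N :=
  (if s ∈ quotSet e u (next e u t j) then
      (quotCoeff e u t j * quotCoeff e u s (next e u t j)) • Y (next e u s (next e u t j))
    else 0) -
  (if s ∈ quotSet e u (next e u t j) then 0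
    else (((-1 : K) ^ (u j).card) • (gen e s * quotCoeff e u t j)) • Y (next e u t j))

theorem restTerm_self (hanti : ∀ i j, u i ⊆ u j → i = j) (Y : Fin r → N) {j : Fin r} {t : Fin n}
    (ht : t ∈ quotSet e u j) : restTerm e u Y j t t = 0 := by
  by_cases h : t ∈ u j
  · simp [restTerm, quotCoeff_of_mem h]
  · have h' := mem_next hanti ht h
    simp [restTerm, mem_quotSet_of_mem h', quotCoeff_of_mem h']

theorem restTerm_of_mem_left (Y : Fin r → N) {j : Fin r} {s t : Fin n} (h : t ∈ u j) :
    restTerm e u Y j t s = 0 := by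
  simp [restTerm, quotCoeff_of_mem h]

/-- Either `s` divides g(e_t u_j) and the second quotient coefficient is zero by convention, or `s`
divides the first quotient and e_s annihilates it. -/
theorem restTerm_of_mem_right (Y : Fin r → N) {j : Fin r} {s t : Fin n} (h : s ∈ u j) :
    restTerm e u Y j t s = 0 := by
  by_cases ht : t ∈ u j
  · exact restTerm_of_mem_left Y ht
  by_cases hs : s ∈ quotSet e u (next e u t j)
  · have : s ∈ u (next e u t j) :=
      by_contra fun hc => notMem_quotSet_next ht (Finset.mem_insert_of_mem h) hc hs
    simp [restTerm, hs, quotCoeff_of_mem this]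
  · obtain ⟨c, hc⟩ := quotCoeff_eq (e := e) ht
    have h0 : gen e s * quotCoeff e u t j = 0 := by
      rw [hc, mul_smul_comm, gen_mul_mono_of_mem, smul_zero]
      exact Finset.mem_sdiff.2
        ⟨Finset.mem_insert_of_mem h, fun hc => hs (mem_quotSet_of_mem hc)⟩
    simp [restTerm, hs, h0]

/-- The route through `t` ends at g(e_s e_t u_j). If the route through `s` also takes two steps, the
second-order coefficients anticommute; if it stops after one, its leftover first-order term is
exactly what is needed. -/
theorem restTerm_add_restTerm_aux (hlin : HasLinearQuotients e u) (hreg : IsRegularDecomp e u)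
    (Y : Fin r → N) {j : Fin r} {s t : Fin n} (hst : s ≠ t)
    (hsj : s ∉ u j) (htj : t ∉ u j) (h1 : s ∈ quotSet e u (next e u t j)) :
    restTerm e u Y j t s + restTerm e u Y j s t = 0 := by
  have hs' : s ∉ u (next e u t j) := fun h => by
    simpa [hst, hsj] using next_subset htj h
  have ht' : t ∉ u (next e u s j) := fun h => by
    simpa [hst.symm, htj] using next_subset hsj h
  have hleast := isLeast_of_mem hlin hreg htj h1 hs'
  by_cases h2 : t ∈ quotSet e u (next e u s j)
  · have hh := hleast.unique (Finset.insert_comm t s (u j) ▸ isLeast_of_mem hlin hreg hsj h2 ht')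
    simp only [restTerm, if_pos h1, if_pos h2, sub_zero]
    rw [hh, ← add_smul, quotCoeff_mul_quotCoeff_add htj hsj hst hs' ht' hh, zero_smul]
  · have hh := hleast.unique (Finset.insert_comm t s (u j) ▸ isLeast_of_notMem hlin hsj h2)
    simp only [restTerm, if_pos h1, if_neg h2, sub_zero, zero_sub]
    rw [hh, quotCoeff_mul_quotCoeff_sub htj hsj hst hs' ht' hh, add_neg_cancel]

theorem restTerm_add_restTerm (hanti : ∀ i j, u i ⊆ u j → i = j)
    (hlin : HasLinearQuotients e u) (hreg : IsRegularDecomp e u)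
    (Y : Fin r → N) {j : Fin r} {s t : Fin n} (hst : s ≠ t)
    (ht : t ∈ quotSet e u j) :
    restTerm e u Y j t s + restTerm e u Y j s t = 0 := by
  by_cases hsj : s ∈ u j
  · rw [restTerm_of_mem_left Y hsj, restTerm_of_mem_right Y hsj, add_zero]
  by_cases htj : t ∈ u j
  · rw [restTerm_of_mem_left Y htj, restTerm_of_mem_right Y htj, add_zero]
  by_cases h1 : s ∈ quotSet e u (next e u t j)
  · exact restTerm_add_restTerm_aux hlin hreg Y hst hsj htj h1
  by_cases h2 : t ∈ quotSet e u (next e u s j)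
  · rw [add_comm]
    exact restTerm_add_restTerm_aux hlin hreg Y hst.symm htj hsj h2
  -- Both first steps would already reach g(e_s e_t u_j), so `t`, which divides g(e_t u_j), would
  -- divide g(e_s u_j) and hence lie in its set.
  · exfalso
    have hh := (isLeast_of_notMem hlin htj h1).unique
      (Finset.insert_comm t s (u j) ▸ isLeast_of_notMem hlin hsj h2)
    exact h2 (hh ▸ mem_quotSet_of_mem (mem_next hanti ht htj))

end Cancellation

end SquareZero

/-! ### The differential on basis symbols, and d² = 0. -/

section Differential

variable {K V : Type*} [Field K] [AddCommGroup V] [Module K V] {n r : ℕ}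
  {e : Module.Basis (Fin n) K V} {u : Fin r → Finset (Fin n)}

section Symbols

variable {N : Type*} [AddCommGroup N]

theorem symb_of_admissible {i : ℕ} (f : Idx e u i → N) {a : Fin n → ℕ} {j : Fin r}
    (h : Admissible e u i a j) : symb e u f a j = f ⟨(a, j), h⟩ :=
  dif_pos h

theorem symb_of_not_admissible {i : ℕ} (f : Idx e u i → N) {a : Fin n → ℕ} {j : Fin r}
    (h : ¬ Admissible e u i a j) : symb e u f a j = 0 :=
  dif_neg h

variable [Module (ExteriorAlgebra K V) N]

theorem diffSucc_eq {i : ℕ} (f : Idx e u i → N) (a : Fin n → ℕ) (j : Fin r) :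
    diffSucc e u f a j = ∑ t with a t ≠ 0,
      (-((((-1 : K) ^ (u j).card) • gen e t) • symb e u f (a - Pi.single t 1) j) +
        quotCoeff e u t j • symb e u f (a - Pi.single t 1) (next e u t j)) := by
  rw [diffSucc, Finset.sum_add_distrib, Finset.sum_neg_distrib, ← Finset.filter_filter,
    Finset.sum_filter (fun t => t ∉ u j)]
  congr 1
  · simp_rw [neg_one_pow_mul_eq_smul]
  · refine Finset.sum_congr rfl fun t _ => ?_
    by_cases h : t ∈ u j
    · simp [h, quotCoeff_of_mem]
    · rw [if_pos h, quotCoeff, if_neg h, neg_one_pow_mul_eq_smul]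

theorem map_symb {N' : Type*} [AddCommGroup N'] [Module (ExteriorAlgebra K V) N'] {i : ℕ}
    (φ : N →ₗ[ExteriorAlgebra K V] N') (f : Idx e u i → N) (a : Fin n → ℕ) (j : Fin r) :
    φ (symb e u f a j) = symb e u (fun p => φ (f p)) a j := by
  by_cases h : Admissible e u i a j
  · simp [symb_of_admissible _ h]
  · simp [symb_of_not_admissible _ h]

/-- The formula is natural in the symbols, so an isomorphism from F transports it unchanged to
another resolution. -/
theorem map_diffSucc {N' : Type*} [AddCommGroup N'] [Module (ExteriorAlgebra K V) N'] {i : ℕ}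
    (φ : N →ₗ[ExteriorAlgebra K V] N') (f : Idx e u i → N) (a : Fin n → ℕ) (j : Fin r) :
    φ (diffSucc e u f a j) = diffSucc e u (fun p => φ (f p)) a j := by
  simp [diffSucc_eq, map_symb]

end Symbols

theorem sub_single_add_single {a : Fin n → ℕ} {t : Fin n} (h : a t ≠ 0) :
    a - Pi.single t 1 + Pi.single t 1 = a := by
  funext k
  by_cases hk : k = t
  · subst hk
    simp
    omega
  · simp [hk]

theorem sum_sub_single {a : Fin n → ℕ} {t : Fin n} (h : a t ≠ 0) :
    ∑ k, (a - Pi.single t 1 : Fin n → ℕ) k + 1 = ∑ k, a k := by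
  conv_rhs => rw [← sub_single_add_single h]
  simp [Finset.sum_add_distrib]

theorem Admissible.sub_single {i : ℕ} {a : Fin n → ℕ} {j : Fin r} (h : Admissible e u (i + 1) a j)
    {t : Fin n} (ht : a t ≠ 0) : Admissible e u i (a - Pi.single t 1) j := by
  refine ⟨?_, fun k hk => h.2 k fun h0 => hk (by simp [h0])⟩
  have := sum_sub_single ht
  have := h.1
  omega

theorem Admissible.mono {i : ℕ} {a : Fin n → ℕ} {j j' : Fin r} (h : Admissible e u i a j)
    (hj : quotSet e u j ⊆ quotSet e u j') : Admissible e u i a j' :=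
  ⟨h.1, fun k hk => hj (h.2 k hk)⟩

theorem Admissible.of_sub_single {i : ℕ} {a : Fin n → ℕ} {j : Fin r} {t : Fin n}
    (h : Admissible e u i (a - Pi.single t 1) j) (hat : a t ≠ 0) (ht : t ∈ quotSet e u j) :
    Admissible e u (i + 1) a j := by
  refine ⟨by rw [← sum_sub_single hat, h.1], fun k hk => ?_⟩
  by_cases hkt : k = t
  · rwa [hkt]
  · exact h.2 k (by simpa [hkt] using hk)

theorem Fd_zero_fbasis (p : Idx e u 0) :
    Fd e u 0 (fbasis e u 0 p) = diffZero e u p.1.2 • fone e u := by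
  simp only [Fd, fbasis]
  erw [Finsupp.linearCombination_single, one_smul]

theorem Fd_succ_fbasis (i : ℕ) (p : Idx e u (i + 1)) :
    Fd e u (i + 1) (fbasis e u (i + 1) p) = diffSucc e u (fbasis e u i) p.1.1 p.1.2 := by
  simp only [Fd, fbasis]
  erw [Finsupp.linearCombination_single, one_smul]

theorem Fd_symb (i : ℕ) (a : Fin n → ℕ) (j : Fin r) :
    Fd e u (i + 1) (symb e u (fbasis e u (i + 1)) a j) =
      if Admissible e u (i + 1) a j then diffSucc e u (fbasis e u i) a j else 0 := by
  split_ifs with h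
  · rw [symb_of_admissible _ h, Fd_succ_fbasis]
  · rw [symb_of_not_admissible _ h, map_zero]

theorem Fmod_hom_ext {i : ℕ} {N : Type*} [AddCommGroup N] [Module (ExteriorAlgebra K V) N]
    {φ ψ : FMod e u (i + 1) →ₗ[ExteriorAlgebra K V] N}
    (h : ∀ p, φ (fbasis e u i p) = ψ (fbasis e u i p)) : φ = ψ :=
  Finsupp.lhom_ext' fun p => LinearMap.ext_ring (h p)

theorem Fd_zero_comp_Fd_one : Fd e u 0 ∘ₗ Fd e u 1 = 0 := by
  refine Fmod_hom_ext fun p => ?_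
  obtain ⟨⟨a, j⟩, ha⟩ := p
  rw [LinearMap.comp_apply, Fd_succ_fbasis, diffSucc_eq, map_sum, LinearMap.zero_apply]
  refine Finset.sum_eq_zero fun t ht => ?_
  replace ht : a t ≠ 0 := by simpa using ht
  -- Since |a| = 1, a − ε_t is zero and no symbol here vanishes.
  have hadm : ∀ k, Admissible e u 0 (a - Pi.single t 1) k := by
    intro k
    have h1 := (ha.sub_single ht).1
    refine ⟨h1, fun l hl => absurd ?_ hl⟩
    rw [Finset.sum_eq_zero_iff] at h1
    exact h1 l (Finset.mem_univ l)
  rw [map_add, map_neg, map_smul, map_smul, symb_of_admissible _ (hadm _),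
    symb_of_admissible _ (hadm _), Fd_zero_fbasis, Fd_zero_fbasis, smul_smul, smul_smul,
    ← neg_smul, ← add_smul]
  simp only [diffZero, neg_one_pow_mul_eq_smul, mul_smul_comm, smul_mul_assoc,
    neg_one_pow_smul_smul]
  by_cases htj : t ∈ u j
  · simp [quotCoeff_of_mem htj, gen_mul_mono_of_mem e htj]
  · rw [quotCoeff_mul_mono htj, neg_one_pow_smul_smul, neg_add_cancel, zero_smul]

/-- `(e_t u / g) d f(a - ε_t; g)`, for `g = g(e_t u)`, expanded as a sum over all `s` in the
support of `a - ε_t`, whether or not `f(a - ε_t; g)` vanishes. -/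
theorem quotCoeff_smul_Fd_symb (hreg : IsRegularDecomp e u) {i : ℕ} {a : Fin n → ℕ} {j : Fin r}
    {t : Fin n} :
    quotCoeff e u t j • Fd e u (i + 1) (symb e u (fbasis e u (i + 1)) a (next e u t j)) =
      ∑ s with a s ≠ 0,
        ((((-1 : K) ^ (u j).card) • (gen e s * quotCoeff e u t j)) •
            symb e u (fbasis e u i) (a - Pi.single s 1) (next e u t j) +
          restTerm e u (symb e u (fbasis e u i) (a - Pi.single s 1)) j t s) := by
  rw [Fd_symb]
  split_ifs with h
  · rw [diffSucc_eq, Finset.smul_sum]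
    refine Finset.sum_congr rfl fun s hs => ?_
    replace hs : a s ≠ 0 := by simpa using hs
    rw [restTerm, if_pos (h.2 s hs), if_pos (h.2 s hs), sub_zero, smul_add, smul_smul, smul_neg,
      smul_smul, mul_smul_comm, quotCoeff_mul_gen, smul_smul, ← neg_smul, ← neg_smul]
    congr 3
    rw [← pow_add, ← mul_neg_one, ← pow_succ]
    exact neg_one_pow_congr (by simp only [Nat.even_add_one, Nat.even_add]; tauto)
  · rw [smul_zero]
    symm
    refine Finset.sum_eq_zero fun s hs => ?_
    replace hs : a s ≠ 0 := by simpa using hs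
    rw [restTerm]
    by_cases hsS : s ∈ quotSet e u (next e u t j)
    -- If f(a − ε_s; g) were nonzero, so would be f(a; g), as s ∈ set(g). Regularity passes the
    -- vanishing on to f(a − ε_s; g(e_s g)).
    · have h1 : ¬ Admissible e u i (a - Pi.single s 1) (next e u t j) :=
        fun h' => h (h'.of_sub_single hs hsS)
      rw [if_pos hsS, if_pos hsS, symb_of_not_admissible _ h1]
      by_cases hsu : s ∈ u (next e u t j)
      · simp [quotCoeff_of_mem hsu]
      · rw [symb_of_not_admissible _ fun h' => h1 (h'.mono (hreg _ s hsS hsu))]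
        simp
    · simp [if_neg hsS]

/-- The diagonal is a separate hypothesis, since antisymmetry alone does not kill it in
characteristic 2. -/
theorem sum_sum_eq_zero_of_alternating {ι N : Type*} [Fintype ι] [AddCommGroup N] (G : ι → ι → N)
    (h0 : ∀ t, G t t = 0) (h1 : ∀ s t, s ≠ t → G t s + G s t = 0) : ∑ t, ∑ s, G t s = 0 := by
  rw [← Finset.sum_product' Finset.univ Finset.univ G]
  refine Finset.sum_involution (fun x _ => x.swap) ?_ ?_ (by simp) (by simp)
  · rintro ⟨t, s⟩ -
    by_cases hst : s = t
    · subst hst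
      simp [h0]
    · exact h1 s t hst
  · rintro ⟨t, s⟩ - hne heq
    have : s = t := congrArg Prod.fst heq
    subst this
    exact hne (h0 s)

theorem Fd_comp_Fd_succ (hanti : ∀ i j, u i ⊆ u j → i = j) (hlin : HasLinearQuotients e u)
    (hreg : IsRegularDecomp e u) (i : ℕ) : Fd e u (i + 1) ∘ₗ Fd e u (i + 2) = 0 := by
  refine Fmod_hom_ext fun p => ?_
  obtain ⟨⟨a, j⟩, ha⟩ := p
  rw [LinearMap.comp_apply, Fd_succ_fbasis, LinearMap.zero_apply]
  set Y : Fin n → Fin n → Fin r → FMod e u (i + 1) := fun t s =>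
    symb e u (fbasis e u i) (a - Pi.single t 1 - Pi.single s 1) with hY
  have hYsymm : ∀ s t, Y s t = Y t s := fun s t => by
    simp only [hY]
    rw [tsub_right_comm]
  -- Under t ↔ s the product e_t e_s changes sign, the two mixed terms e_t q_s and e_s q_t exchange
  -- with opposite signs, and `restTerm` is antisymmetric.
  set G : Fin n → Fin n → FMod e u (i + 1) := fun t s =>
    (gen e t * gen e s) • Y t s j -
      (((-1 : K) ^ (u j).card) • (gen e t * quotCoeff e u s j)) • Y t s (next e u s j) +
      ((((-1 : K) ^ (u j).card) • (gen e s * quotCoeff e u t j)) • Y t s (next e u t j) +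
        restTerm e u (Y t s) j t s) with hG
  have hsum : Fd e u (i + 1) (diffSucc e u (fbasis e u (i + 1)) a j) =
      ∑ t, ∑ s, if a t ≠ 0 ∧ (a - Pi.single t 1 : Fin n → ℕ) s ≠ 0 then G t s else 0 := by
    rw [diffSucc_eq, map_sum, Finset.sum_filter]
    refine Finset.sum_congr rfl fun t _ => ?_
    by_cases ht : a t ≠ 0
    swap
    · simp [ht]
    simp only [ht, ne_eq, not_false_eq_true, true_and, if_true]
    rw [← Finset.sum_filter, map_add, map_neg, map_smul, map_smul, quotCoeff_smul_Fd_symb hreg,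
      Fd_symb, if_pos (ha.sub_single ht), diffSucc_eq, Finset.smul_sum, ← Finset.sum_neg_distrib,
      ← Finset.sum_add_distrib]
    refine Finset.sum_congr rfl fun s _ => ?_
    rw [hG]
    simp only [hY]
    congr 1
    rw [smul_add, smul_neg, smul_smul, smul_smul, smul_mul_smul_comm, smul_mul_assoc,
      ← mul_pow]
    simp [sub_eq_add_neg, add_comm]
  change Fd e u (i + 1) (diffSucc e u (fbasis e u (i + 1)) a j) = 0
  rw [hsum]
  refine sum_sum_eq_zero_of_alternating _ (fun t => ?_) fun s t hst => ?_
  · by_cases h : a t ≠ 0 ∧ (a - Pi.single t 1 : Fin n → ℕ) t ≠ 0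
    · rw [if_pos h, hG]
      simp [restTerm_self hanti _ (ha.2 t h.1), gen_mul_self]
    · rw [if_neg h]
  · have hiff : (a s ≠ 0 ∧ (a - Pi.single s 1 : Fin n → ℕ) t ≠ 0) ↔
        (a t ≠ 0 ∧ (a - Pi.single t 1 : Fin n → ℕ) s ≠ 0) := by
      simp [hst, hst.symm, and_comm]
    by_cases h : a t ≠ 0 ∧ (a - Pi.single t 1 : Fin n → ℕ) s ≠ 0
    · rw [if_pos h, if_pos (hiff.2 h), hG]
      simp only [hYsymm s t]
      have h1 := restTerm_add_restTerm hanti hlin hreg (Y t s) hst (ha.2 t h.1)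
      rw [gen_mul_gen_swap e s t, neg_smul]
      rw [add_eq_zero_iff_eq_neg] at h1
      rw [h1]
      abel
    · rw [if_neg h, if_neg (hiff.not.2 h), add_zero]

end Differential

/-! ### Exactness by matching monomials. -/

section Exactness

variable {K V : Type*} [Field K] [AddCommGroup V] [Module K V] {n r : ℕ}
  {e : Module.Basis (Fin n) K V} {u : Fin r → Finset (Fin n)}

/-- The coordinate at `f(a; u_j)`, as a linear form; it is `0` if `f(a; u_j) = 0`. -/
def coordAt (e : Module.Basis (Fin n) K V) (u : Fin r → Finset (Fin n)) (i : ℕ) (a : Fin n → ℕ)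
    (j : Fin r) : FMod e u (i + 1) →ₗ[ExteriorAlgebra K V] ExteriorAlgebra K V :=
  if h : Admissible e u i a j then
    Finsupp.lapply (show FIdx e u (i + 1) from ⟨(a, j), h⟩)
  else 0

theorem coordAt_apply (i : ℕ) (p : Idx e u i) (z : FMod e u (i + 1)) :
    coordAt e u i p.1.1 p.1.2 z = z p := by
  rw [coordAt, dif_pos p.2]
  rfl

theorem coordAt_fbasis (i : ℕ) (a : Fin n → ℕ) (j : Fin r) (p : Idx e u i) :
    coordAt e u i a j (fbasis e u i p) = if p.1 = (a, j) then 1 else 0 := by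
  by_cases h : Admissible e u i a j
  · rw [coordAt, dif_pos h, Finsupp.lapply_apply, fbasis, Finsupp.single_apply]
    exact if_congr ⟨fun h => congrArg Subtype.val h, fun h => Subtype.ext h⟩ rfl rfl
  · rw [coordAt, dif_neg h, if_neg, LinearMap.zero_apply]
    rintro hp
    have := p.2
    rw [hp] at this
    exact h this

theorem coordAt_symb {i : ℕ} {a b : Fin n → ℕ} {j k : Fin r} (h : Admissible e u i a j) :
    coordAt e u i a j (symb e u (fbasis e u i) b k) = if (b, k) = (a, j) then 1 else 0 := by
  by_cases h' : Admissible e u i b k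
  · rw [symb_of_admissible _ h', coordAt_fbasis]
  · rw [symb_of_not_admissible _ h', map_zero, if_neg]
    intro heq
    rw [Prod.mk.injEq] at heq
    rw [heq.1, heq.2] at h'
    exact h' h

theorem single_eq_smul_symb (i : ℕ) (p : Idx e u i) (x : ExteriorAlgebra K V) :
    (Finsupp.single (show FIdx e u (i + 1) from p) x : FMod e u (i + 1)) =
      x • symb e u (fbasis e u i) p.1.1 p.1.2 := by
  rw [symb_of_admissible _ p.2, fbasis, Finsupp.smul_single, smul_eq_mul, mul_one]

/-- The monomial `e_μ f(a; u_j)` is matched if the largest element of `set(u_j)` occurring in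
`μ` or in `a` occurs in `μ`. -/
def IsMatched (e : Module.Basis (Fin n) K V) (u : Fin r → Finset (Fin n)) (μ : Finset (Fin n))
    (a : Fin n → ℕ) (j : Fin r) : Prop :=
  ∃ m ∈ μ, m ∈ quotSet e u j ∧ ∀ k ∈ quotSet e u j, m < k → k ∉ μ ∧ a k = 0

theorem exists_max_of_not_isMatched {μ : Finset (Fin n)} {a : Fin n → ℕ} {j : Fin r}
    (h : ¬ IsMatched e u μ a j) {k : Fin n} (hk : k ∈ quotSet e u j) (hk' : k ∈ μ ∨ a k ≠ 0) :
    ∃ m ∈ quotSet e u j, m ∉ μ ∧ a m ≠ 0 ∧ ∀ l ∈ quotSet e u j, m < l → l ∉ μ ∧ a l = 0 := by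
  set s : Finset (Fin n) := Finset.univ.filter fun l => l ∈ quotSet e u j ∧ (l ∈ μ ∨ a l ≠ 0)
    with hs
  have hne : s.Nonempty := ⟨k, by simp only [hs, Finset.mem_filter_univ]; exact ⟨hk, hk'⟩⟩
  have hm := s.max'_mem hne
  simp only [hs, Finset.mem_filter_univ] at hm
  have hmax : ∀ l ∈ quotSet e u j, s.max' hne < l → l ∉ μ ∧ a l = 0 := by
    intro l hl hlt
    have : l ∉ s := fun hls => hlt.not_ge (s.le_max' l hls)
    simp only [hs, Finset.mem_filter_univ, not_and, not_or, not_not] at this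
    exact this hl
  have hnot : s.max' hne ∉ μ := fun hmem => h ⟨_, hmem, hm.1, hmax⟩
  exact ⟨_, hm.1, hnot, hm.2.resolve_left hnot, hmax⟩

/-- The span of the unmatched monomials. -/
def unmatched (e : Module.Basis (Fin n) K V) (u : Fin r → Finset (Fin n)) (i : ℕ) :
    Submodule K (FMod e u (i + 1)) where
  carrier := {z | ∀ a j μ, IsMatched e u μ a j → coef e μ (coordAt e u i a j z) = 0}
  add_mem' := fun hx hy a j μ h => by rw [map_add, map_add, hx a j μ h, hy a j μ h, add_zero]
  zero_mem' := fun a j μ _ => by simp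
  smul_mem' := fun c x hx a j μ h => by
    rw [LinearMap.map_smul_of_tower, map_smul, hx a j μ h, smul_zero]

theorem mono_smul_symb_mem_unmatched {i : ℕ} {μ : Finset (Fin n)} {a : Fin n → ℕ} {j : Fin r}
    (h : ¬ IsMatched e u μ a j) :
    mono e μ • symb e u (fbasis e u i) a j ∈ unmatched e u i := by
  intro b k ν hν
  by_cases hadm : Admissible e u i a j
  · rw [symb_of_admissible _ hadm, map_smul, coordAt_fbasis]
    split_ifs with heq
    · simp only [Prod.mk.injEq] at heq
      rw [smul_eq_mul, mul_one, coef_mono, if_neg]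
      rintro rfl
      rw [heq.1, heq.2] at h
      exact h hν
    · simp
  · simp [symb_of_not_admissible _ hadm]

/-- A matched e_μ f(a;u_j) is, up to a nonzero scalar, a term of d(e_{μ∖m} f(a + ε_m; u_j)) with m
the matched maximum. The other terms are unmatched or involve a smaller generator index, to which
the induction applies. -/
theorem smul_symb_mem_range_sup_unmatched {i : ℕ} (j : Fin r) : ∀ (x : ExteriorAlgebra K V)
    (a : Fin n → ℕ), x • symb e u (fbasis e u i) a j ∈
      (LinearMap.range (Fd e u (i + 1))).restrictScalars K ⊔ unmatched e u i := by
  induction j using WellFoundedLT.induction with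
  | ind j ih =>
  intro x a
  set W := (LinearMap.range (Fd e u (i + 1))).restrictScalars K ⊔ unmatched e u i with hW
  have hup : ∀ {μ b}, ¬ IsMatched e u μ b j → mono e μ • symb e u (fbasis e u i) b j ∈ W :=
    fun h => Submodule.mem_sup_right (mono_smul_symb_mem_unmatched h)
  by_cases hadm : Admissible e u i a j
  swap
  · simp [symb_of_not_admissible _ hadm]
  rw [← sum_coef e x, Finset.sum_smul]
  refine Submodule.sum_mem _ fun μ _ => ?_
  rw [smul_assoc]
  refine Submodule.smul_mem _ _ ?_
  by_cases hμ : IsMatched e u μ a j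
  swap
  · exact hup hμ
  obtain ⟨m, hmμ, hmS, hmax⟩ := hμ
  set a' : Fin n → ℕ := a + Pi.single m 1 with ha'
  have ham : a' m ≠ 0 := by simp [ha']
  have hsub : a' - Pi.single m 1 = a := by simp [ha']
  have hadm' : Admissible e u (i + 1) a' j :=
    Admissible.of_sub_single (t := m) (hsub.symm ▸ hadm) ham hmS
  have hd : mono e (μ.erase m) • diffSucc e u (fbasis e u i) a' j ∈ W := by
    refine Submodule.mem_sup_left ?_
    rw [Submodule.restrictScalars_mem]
    refine Submodule.smul_mem _ _ ⟨fbasis e u (i + 1) ⟨(a', j), hadm'⟩, ?_⟩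
    rw [Fd_succ_fbasis]
  rw [diffSucc_eq, Finset.smul_sum, ← Finset.add_sum_erase _ _
    (show m ∈ Finset.univ.filter fun t => a' t ≠ 0 by simpa using ham)] at hd
  have hsecond : ∀ t, a' t ≠ 0 → ∀ b (y : ExteriorAlgebra K V),
      y • quotCoeff e u t j • symb e u (fbasis e u i) b (next e u t j) ∈ W := by
    intro t ht b y
    by_cases htj : t ∈ u j
    · simp [quotCoeff_of_mem htj]
    · rw [smul_smul]
      exact ih _ (next_lt (hadm'.2 t ht) htj) _ _
  rw [Submodule.add_mem_iff_left] at hd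
  · rw [hsub, smul_add, smul_neg] at hd
    rw [Submodule.add_mem_iff_left _ (hsecond m ham _ _), Submodule.neg_mem_iff, smul_smul,
      mul_smul_comm, ← mono_singleton, mono_mul_mono, smul_smul, smul_assoc,
      Finset.union_singleton, Finset.insert_erase hmμ] at hd
    refine (Submodule.smul_mem_iff _ ?_).1 hd
    exact mul_ne_zero (pow_ne_zero _ (by simp)) (sgn_ne_zero e (by simp))
  · refine Submodule.sum_mem _ fun t ht => ?_
    simp only [Finset.mem_erase, Finset.mem_filter_univ] at ht
    obtain ⟨htm, ht⟩ := ht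
    rw [smul_add, smul_neg]
    refine Submodule.add_mem _ (Submodule.neg_mem _ ?_) (hsecond t ht _ _)
    rw [smul_smul, mul_smul_comm, ← mono_singleton, mono_mul_mono, smul_smul, smul_assoc]
    refine Submodule.smul_mem _ _ (hup ?_)
    -- In this term `m` still occurs in the exponent but no longer in the monomial, and nothing of
    -- set(u_j) above `m` occurs, so it cannot be matched.
    rintro ⟨l, hl, hlS, hlmax⟩
    have hltm : ¬ l < m := fun hlt => by
      have := (hlmax m hmS hlt).2
      simp [ha', Ne.symm htm] at this
    have hlm : l ≠ m := by
      rintro rfl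
      simp [Ne.symm htm] at hl
    have hml : m < l := lt_of_le_of_ne (not_lt.1 hltm) hlm.symm
    have hl0 := hmax l hlS hml
    have hlt : l ≠ t := by
      rintro rfl
      simp [ha', hlm, hl0.2] at ht
    simp [hlt, hl0.1] at hl

theorem range_sup_unmatched (i : ℕ) :
    (LinearMap.range (Fd e u (i + 1))).restrictScalars K ⊔ unmatched e u i = ⊤ := by
  rw [eq_top_iff]
  rintro z -
  induction z using Finsupp.induction_linear with
  | zero => exact Submodule.zero_mem _
  | add x y hx hy => exact Submodule.add_mem _ hx hy
  | single p x =>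
    erw [single_eq_smul_symb i p x]
    exact smul_symb_mem_range_sup_unmatched _ _ _

/-- The second sum of d strictly lowers the generator index, so at the largest index present only
the first, Cartan-like sum contributes. -/
theorem coordAt_Fd_succ {i : ℕ} {b : Fin n → ℕ} {j : Fin r} (hb : Admissible e u i b j)
    {z : FMod e u (i + 2)} (hz : ∀ a k, j < k → coordAt e u (i + 1) a k z = 0) :
    coordAt e u i b j (Fd e u (i + 1) z) =
      -∑ t, ((-1 : K) ^ (u j).card) •
        (coordAt e u (i + 1) (b + Pi.single t 1) j z * gen e t) := by
  set B : FMod e u (i + 2) →ₗ[ExteriorAlgebra K V] ExteriorAlgebra K V :=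
    -∑ t, (LinearMap.toSpanSingleton (ExteriorAlgebra K V) (ExteriorAlgebra K V)
      (((-1 : K) ^ (u j).card) • gen e t)) ∘ₗ coordAt e u (i + 1) (b + Pi.single t 1) j with hB
  have hBz : ∀ z, B z = -∑ t, ((-1 : K) ^ (u j).card) •
        (coordAt e u (i + 1) (b + Pi.single t 1) j z * gen e t) := by
    intro z
    simp [hB]
  rw [← hBz]
  have key : ∀ p : Idx e u (i + 1), p.1.2 ≤ j →
      coordAt e u i b j (Fd e u (i + 1) (fbasis e u (i + 1) p)) = B (fbasis e u (i + 1) p) := by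
    rintro ⟨⟨a, k⟩, ha⟩ hk
    change k ≤ j at hk
    rw [Fd_succ_fbasis, diffSucc_eq, map_sum, hBz, Finset.sum_filter, ← Finset.sum_neg_distrib]
    refine Finset.sum_congr rfl fun t _ => ?_
    rw [coordAt_fbasis]
    by_cases hat : a t = 0
    · rw [if_neg (by simpa using hat), if_neg, zero_mul, smul_zero, neg_zero]
      intro heq
      simp only [Prod.mk.injEq] at heq
      have := congrFun heq.1 t
      simp [hat] at this
    · have h2 : quotCoeff e u t k • coordAt e u i b j
          (symb e u (fbasis e u i) (a - Pi.single t 1) (next e u t k)) = 0 := by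
        by_cases htk : t ∈ u k
        · simp [quotCoeff_of_mem htk]
        · rw [coordAt_symb hb, if_neg, smul_zero]
          intro heq
          simp only [Prod.mk.injEq] at heq
          exact ((next_lt (ha.2 t hat) htk).trans_le hk).ne heq.2
      rw [if_pos hat, map_add, map_neg, map_smul, map_smul, h2, add_zero, coordAt_symb hb]
      have hiff : (a - Pi.single t 1, k) = (b, j) ↔ (a, k) = (b + Pi.single t 1, j) := by
        simp only [Prod.mk.injEq, and_congr_left_iff]
        rintro -
        constructor
        · rintro rfl
          exact (sub_single_add_single hat).symm
        · rintro rfl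
          simp
      by_cases heq : (a, k) = (b + Pi.single t 1, j)
      · rw [if_pos (hiff.2 heq), if_pos heq]
        simp only [Prod.mk.injEq] at heq
        simp [heq.2]
      · rw [if_neg (hiff.not.2 heq), if_neg heq]
        simp
  rw [← LinearMap.comp_apply]
  conv_lhs => rw [← Finsupp.sum_single z]
  conv_rhs => rw [← Finsupp.sum_single z]
  rw [map_finsuppSum, map_finsuppSum]
  refine Finsupp.sum_congr fun p hp => ?_
  have hpj : (show Idx e u (i + 1) from p).1.2 ≤ j := by
    by_contra hlt
    exact (Finsupp.mem_support_iff.1 hp)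
      ((coordAt_apply (i + 1) p z).symm.trans (hz _ _ (not_le.1 hlt)))
  have h1 := key p hpj
  erw [single_eq_smul_symb (i + 1) p]
  rw [symb_of_admissible _ p.2, map_smul, map_smul]
  congr 1

theorem eq_zero_of_coordAt {i : ℕ} {z : FMod e u (i + 1)} (h : ∀ j a, coordAt e u i a j z = 0) :
    z = 0 := by
  refine Finsupp.ext fun p => ?_
  exact (coordAt_apply i p z).symm.trans (h p.1.2 p.1.1)

theorem eq_zero_of_Fd_succ_eq_zero {i : ℕ} {z : FMod e u (i + 2)} (hz : z ∈ unmatched e u (i + 1))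
    (h : Fd e u (i + 1) z = 0) : z = 0 := by
  refine eq_zero_of_coordAt fun j => ?_
  induction j using WellFoundedGT.induction with
  | ind j ih =>
  intro a
  by_cases ha : Admissible e u (i + 1) a j
  swap
  · rw [coordAt, dif_neg ha, LinearMap.zero_apply]
  refine ext_coef e fun μ => ?_
  rw [map_zero]
  by_cases hμ : IsMatched e u μ a j
  · exact hz a j μ hμ
  -- Positive |a| guarantees an element of set(u_j) to maximize over; |a| = 0 needs the separate
  -- argument below.
  obtain ⟨k, -, hk⟩ : ∃ k ∈ Finset.univ, a k ≠ 0 :=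
    Finset.exists_ne_zero_of_sum_ne_zero (by rw [ha.1]; omega)
  obtain ⟨m, hmS, hmμ, ham, hmax⟩ := exists_max_of_not_isMatched hμ (ha.2 k hk) (Or.inr hk)
  have hcoord := coordAt_Fd_succ (ha.sub_single ham) (fun a k hk => ih k hk a)
  rw [h, map_zero, eq_comm, neg_eq_zero] at hcoord
  -- Compare coefficients at e_{μ∪m} f(a − ε_m; u_j). The term t = m is the wanted coefficient up to
  -- sign; each t ≠ m reads a monomial with maximum `m` inside it, which is matched and so absent.
  have hcoef := congrArg (coef e (insert m μ)) hcoord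
  rw [map_sum, map_zero, Finset.sum_eq_single m] at hcoef
  · rw [sub_single_add_single ham, map_smul, coef_mul_gen, if_pos (Finset.mem_insert_self m μ),
      Finset.erase_insert hmμ, smul_eq_mul, ← mul_assoc] at hcoef
    refine (mul_eq_zero.1 hcoef).resolve_left ?_
    exact mul_ne_zero (pow_ne_zero _ (by simp)) (sgn_ne_zero e (by simpa using hmμ))
  · intro t _ htm
    rw [map_smul, coef_mul_gen]
    split_ifs with ht
    · rw [hz, mul_zero, smul_zero]
      refine ⟨m, by simp [Ne.symm htm], hmS, fun l hl hlt => ?_⟩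
      have h0 := hmax l hl hlt
      have hlt' : l ≠ t := by
        rintro rfl
        simp [htm, h0.1] at ht
      simp [hlt.ne', h0.1, h0.2, hlt']
    · simp
  · simp

theorem Fd_zero_apply (z : FMod e u 1) :
    Fd e u 0 z = (∑ j, coordAt e u 0 0 j z * diffZero e u j) • fone e u := by
  set B : FMod e u 1 →ₗ[ExteriorAlgebra K V] FMod e u 0 :=
    ∑ j, (LinearMap.toSpanSingleton (ExteriorAlgebra K V) (FMod e u 0)
      (diffZero e u j • fone e u)) ∘ₗ coordAt e u 0 0 j with hB
  have hBz : ∀ z, B z = (∑ j, coordAt e u 0 0 j z * diffZero e u j) • fone e u := by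
    intro z
    simp [hB, Finset.sum_smul, mul_smul]
  rw [← hBz]
  congr 1
  refine Fmod_hom_ext fun p => ?_
  obtain ⟨⟨a, j⟩, ha⟩ := p
  have ha0 : a = 0 := by
    funext k
    exact Finset.sum_eq_zero_iff.1 ha.1 k (Finset.mem_univ k)
  subst ha0
  rw [Fd_zero_fbasis, hBz, Finset.sum_eq_single j]
  · simp [coordAt_fbasis]
  · intro k _ hk
    rw [coordAt_fbasis, if_neg (by simpa using hk.symm), zero_mul]
  · simp

theorem fone_smul_eq_zero {x : ExteriorAlgebra K V} (h : x • fone e u = 0) : x = 0 := by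
  have := DFunLike.congr_fun h (show FIdx e u 0 from ())
  rw [Finsupp.smul_apply, fone] at this
  erw [Finsupp.single_eq_same] at this
  rwa [smul_eq_mul, mul_one] at this

/-- The last surviving coordinate lies in the colon ideal of u_j, so by linear quotients each of its
monomials meets set(u_j). With a = 0 such a monomial is matched, hence absent. -/
theorem eq_zero_of_Fd_zero_eq_zero (hlin : HasLinearQuotients e u) {z : FMod e u 1}
    (hz : z ∈ unmatched e u 0) (h : Fd e u 0 z = 0) : z = 0 := by
  refine eq_zero_of_coordAt fun j => ?_
  induction j using WellFoundedGT.induction with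
  | ind j ih =>
  intro a
  by_cases ha : Admissible e u 0 a j
  swap
  · rw [coordAt, dif_neg ha, LinearMap.zero_apply]
  have ha0 : a = 0 := by
    funext k
    exact Finset.sum_eq_zero_iff.1 ha.1 k (Finset.mem_univ k)
  subst ha0
  rw [Fd_zero_apply] at h
  have hsum := fone_smul_eq_zero h
  rw [← Finset.add_sum_erase _ _ (Finset.mem_univ j),
    add_eq_zero_iff_eq_neg] at hsum
  have hcolon : coordAt e u 0 0 j z ∈ colon (idealLT e u j) (mono e (u j)) := by
    rw [mem_colon]
    have h1 : coordAt e u 0 0 j z * diffZero e u j ∈ idealLT e u j := by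
      rw [hsum, Submodule.neg_mem_iff]
      refine Submodule.sum_mem _ fun k hk => ?_
      rcases lt_or_ge j k with hjk | hjk
      · rw [ih k hjk, zero_mul]
        exact Submodule.zero_mem _
      · have hkj : k < j := lt_of_le_of_ne hjk (by simpa using hk)
        refine Ideal.mul_mem_left _ _ (Ideal.mul_mem_left _ _ ?_)
        exact Ideal.subset_span ⟨k, hkj, rfl⟩
    rw [diffZero, neg_one_pow_mul_eq_smul, mul_smul_comm] at h1
    have h2 := Submodule.smul_of_tower_mem (idealLT e u j) ((-1 : K) ^ (u j).card) h1
    rwa [neg_one_pow_smul_smul] at h2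
  refine ext_coef e fun μ => ?_
  rw [map_zero]
  by_contra hne
  obtain ⟨k, hkμ, hkS⟩ := exists_mem_quotSet_of_mem_colon hlin hcolon hne
  by_cases hμ : IsMatched e u μ 0 j
  · exact hne (hz 0 j μ hμ)
  · obtain ⟨m, -, -, hm, -⟩ := exists_max_of_not_isMatched hμ hkS (Or.inl hkμ)
    exact hm rfl

/-- Modulo the image a cycle is a combination of unmatched monomials; this is again a cycle because
d² = 0, and d is injective there. -/
theorem range_Fd_succ_eq_ker (hanti : ∀ i j, u i ⊆ u j → i = j) (hlin : HasLinearQuotients e u)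
    (hreg : IsRegularDecomp e u) (i : ℕ) :
    LinearMap.range (Fd e u (i + 1)) = LinearMap.ker (Fd e u i) := by
  have hcomp : Fd e u i ∘ₗ Fd e u (i + 1) = 0 := by
    cases i with
    | zero => exact Fd_zero_comp_Fd_one
    | succ i => exact Fd_comp_Fd_succ hanti hlin hreg i
  refine le_antisymm (LinearMap.range_le_ker_iff.2 hcomp) fun z hz => ?_
  have hmem : z ∈ (LinearMap.range (Fd e u (i + 1))).restrictScalars K ⊔ unmatched e u i := by
    rw [range_sup_unmatched]
    trivial
  obtain ⟨_, ⟨y, rfl⟩, w, hw, rfl⟩ := Submodule.mem_sup.1 hmem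
  have hw0 : Fd e u i w = 0 := by
    have h1 : Fd e u i (Fd e u (i + 1) y) = 0 := LinearMap.congr_fun hcomp y
    rwa [LinearMap.mem_ker, map_add, h1, zero_add] at hz
  have : w = 0 := by
    cases i with
    | zero => exact eq_zero_of_Fd_zero_eq_zero hlin hw hw0
    | succ i => exact eq_zero_of_Fd_succ_eq_zero hw hw0
  rw [this, add_zero]
  exact ⟨y, rfl⟩

theorem Faug_apply (I : Ideal (ExteriorAlgebra K V)) (z : FMod e u 0) :
    Faug e u I z = Submodule.mkQ I (z (show FIdx e u 0 from ())) := by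
  have hz : z = Finsupp.single (show FIdx e u 0 from ()) (z (show FIdx e u 0 from ())) :=
    Finsupp.ext fun p => by
      change z (show FIdx e u 0 from ()) = _
      erw [Finsupp.single_eq_same]
  conv_lhs => rw [hz]
  rw [Faug, Finsupp.linearCombination_single, ← map_smul, smul_eq_mul, mul_one]

theorem range_Fd_zero_eq_ker {I : Ideal (ExteriorAlgebra K V)} (hI : IsMonomialIdeal e I)
    (hu : EnumeratesMinGens e I u) :
    LinearMap.range (Fd e u 0) = LinearMap.ker (Faug e u I) := by
  have hspan := eq_span_of_enumerates hI hu
  have hmem : ∀ j, mono e (u j) ∈ I := fun j => hspan ▸ Ideal.subset_span ⟨_, ⟨j, rfl⟩, rfl⟩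
  apply le_antisymm
  · rintro _ ⟨z, rfl⟩
    rw [LinearMap.mem_ker, Fd_zero_apply, Faug_apply, Submodule.mkQ_apply,
      Submodule.Quotient.mk_eq_zero, Finsupp.smul_apply, smul_eq_mul]
    simp only [fone]
    erw [Finsupp.single_eq_same]
    rw [mul_one]
    exact Submodule.sum_mem _ fun j _ =>
      Ideal.mul_mem_left _ _ (Ideal.mul_mem_left _ _ (hmem j))
  · intro z hz
    rw [LinearMap.mem_ker, Faug_apply, Submodule.mkQ_apply, Submodule.Quotient.mk_eq_zero] at hz
    have key : ∀ x ∈ I, x • fone e u ∈ LinearMap.range (Fd e u 0) := by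
      intro x hx
      rw [hspan] at hx
      induction hx using Submodule.span_induction with
      | mem y hy =>
        obtain ⟨_, ⟨j, rfl⟩, rfl⟩ := hy
        have hadm : Admissible e u 0 0 j := ⟨by simp, fun k hk => absurd rfl hk⟩
        have h1 : diffZero e u j • fone e u ∈ LinearMap.range (Fd e u 0) :=
          ⟨fbasis e u 0 ⟨(0, j), hadm⟩, Fd_zero_fbasis _⟩
        have h2 := Submodule.smul_mem _ ((-1) ^ (u j).card) h1
        rwa [smul_smul, diffZero, neg_one_pow_mul_eq_smul, neg_one_pow_mul_eq_smul,
          neg_one_pow_smul_smul] at h2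
      | zero => simp
      | add y y' _ _ hy hy' =>
        rw [add_smul]
        exact Submodule.add_mem _ hy hy'
      | smul c y _ hy =>
        rw [smul_assoc]
        exact Submodule.smul_mem _ _ hy
    convert key _ hz using 1
    refine Finsupp.ext fun p => ?_
    rw [Finsupp.smul_apply, fone]
    erw [Finsupp.single_eq_same]
    rw [smul_eq_mul, mul_one]
    rfl

theorem Faug_surjective (I : Ideal (ExteriorAlgebra K V)) :
    Function.Surjective (Faug e u I) := by
  intro x
  obtain ⟨y, rfl⟩ := Submodule.mkQ_surjective I x
  refine ⟨Finsupp.single (show FIdx e u 0 from ()) y, ?_⟩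
  rw [Faug_apply, Finsupp.single_eq_same]

end Exactness

/-! ### Gradings, homogeneity and minimality of the explicit complex. -/

section Grading

variable {K V : Type*} [Field K] [AddCommGroup V] [Module K V]

theorem degPart_natCast (k : ℕ) : degPart K V (k : ℤ) = (⋀[K]^k V).toAddSubgroup := by
  simp [degPart]

theorem degPart_of_neg {k : ℤ} (h : k < 0) : degPart K V k = ⊥ :=
  if_neg (not_le.2 h)

theorem mem_degPart_natCast {k : ℕ} {x : ExteriorAlgebra K V} :
    x ∈ degPart K V (k : ℤ) ↔ x ∈ ⋀[K]^k V := by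
  rw [degPart_natCast]
  rfl

theorem one_mem_degPart : (1 : ExteriorAlgebra K V) ∈ degPart K V 0 :=
  mem_degPart_natCast (k := 0).2 (SetLike.GradedOne.one_mem (A := fun i : ℕ => ⋀[K]^i V))

theorem mul_mem_degPart {k l : ℤ} {x y : ExteriorAlgebra K V} (hx : x ∈ degPart K V k)
    (hy : y ∈ degPart K V l) : x * y ∈ degPart K V (k + l) := by
  rcases lt_or_ge k 0 with hk | hk
  · rw [degPart_of_neg hk, AddSubgroup.mem_bot] at hx
    simp [hx]
  rcases lt_or_ge l 0 with hl | hl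
  · rw [degPart_of_neg hl, AddSubgroup.mem_bot] at hy
    simp [hy]
  lift k to ℕ using hk
  lift l to ℕ using hl
  rw [mem_degPart_natCast] at hx hy
  rw [← Nat.cast_add, mem_degPart_natCast]
  exact SetLike.GradedMul.mul_mem (A := fun i : ℕ => ⋀[K]^i V) hx hy

theorem smul_mem_degPart (c : K) {k : ℤ} {x : ExteriorAlgebra K V} (hx : x ∈ degPart K V k) :
    c • x ∈ degPart K V k := by
  rcases lt_or_ge k 0 with hk | hk
  · rw [degPart_of_neg hk, AddSubgroup.mem_bot] at hx
    simp [hx]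
  lift k to ℕ using hk
  rw [mem_degPart_natCast] at hx ⊢
  exact Submodule.smul_mem _ _ hx

theorem mono_mem_degPart {n : ℕ} (e : Module.Basis (Fin n) K V) (μ : Finset (Fin n)) :
    mono e μ ∈ degPart K V μ.card :=
  mem_degPart_natCast.2 (mono_mem_exteriorPower e μ)

theorem gen_mem_degPart {n : ℕ} (e : Module.Basis (Fin n) K V) (t : Fin n) :
    gen e t ∈ degPart K V 1 := by
  simpa [mono_singleton] using mono_mem_degPart e {t}

/-- The projection of the exterior algebra onto its component of degree `k ∈ ℤ`. -/
def degProj (K V : Type*) [Field K] [AddCommGroup V] [Module K V] (k : ℤ) :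
    ExteriorAlgebra K V →+ ExteriorAlgebra K V :=
  if 0 ≤ k then GradedRing.proj (fun i : ℕ => ⋀[K]^i V) k.toNat else 0

theorem degProj_of_mem {k : ℤ} {x : ExteriorAlgebra K V} (hx : x ∈ degPart K V k) :
    degProj K V k x = x := by
  rcases lt_or_ge k 0 with hk | hk
  · rw [degPart_of_neg hk, AddSubgroup.mem_bot] at hx
    simp [hx]
  lift k to ℕ using hk
  rw [mem_degPart_natCast] at hx
  rw [degProj, if_pos (Int.natCast_nonneg k), Int.toNat_natCast, GradedRing.proj_apply]
  exact DirectSum.decompose_of_mem_same _ hx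

theorem degProj_of_mem_ne {k l : ℤ} {x : ExteriorAlgebra K V} (hx : x ∈ degPart K V l)
    (hkl : l ≠ k) : degProj K V k x = 0 := by
  rcases lt_or_ge l 0 with hl | hl
  · rw [degPart_of_neg hl, AddSubgroup.mem_bot] at hx
    simp [hx]
  rcases lt_or_ge k 0 with hk | hk
  · rw [degProj, if_neg (not_le.2 hk)]
    rfl
  lift k to ℕ using hk
  lift l to ℕ using hl
  rw [mem_degPart_natCast] at hx
  rw [degProj, if_pos (Int.natCast_nonneg k), Int.toNat_natCast, GradedRing.proj_apply]
  exact DirectSum.decompose_of_mem_ne _ hx (by exact_mod_cast hkl)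

/-- Applying π k to a vanishing sum isolates its component of degree k, so no decomposition of M is
needed in advance. -/
theorem isInternal_of_projections {M : Type*} [AddCommGroup M] (gr : ℤ → AddSubgroup M)
    {N : Type*} [AddCommGroup N] (π : ℤ → M →+ N)
    (h_inj : ∀ k, ∀ x ∈ gr k, π k x = 0 → x = 0)
    (h_zero : ∀ k l, ∀ x ∈ gr l, l ≠ k → π k x = 0) (h_top : ⨆ k, gr k = ⊤) :
    DirectSum.IsInternal gr := by
  constructor
  · rw [injective_iff_map_eq_zero]
    intro x hx
    have key : ∀ (k : ℤ) (y : DirectSum ℤ fun k => gr k),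
        π k (DirectSum.coeAddMonoidHom gr y) = π k (y k) := by
      intro k y
      induction y using DirectSum.induction_on with
      | zero => simp
      | of l z =>
        rw [DirectSum.coeAddMonoidHom_of]
        by_cases hlk : l = k
        · subst hlk
          rw [DirectSum.of_eq_same]
        · rw [DirectSum.of_eq_of_ne _ _ _ (Ne.symm hlk), h_zero k l z z.2 hlk]
          simp
      | add y z hy hz => rw [map_add, map_add, hy, hz, DirectSum.add_apply, AddSubgroup.coe_add,
          map_add]
    refine DFinsupp.ext fun k => Subtype.ext ?_
    refine h_inj k _ (x k).2 ?_
    rw [← key, hx, map_zero]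
  · rw [← AddMonoidHom.range_eq_top, eq_top_iff, ← h_top, iSup_le_iff]
    intro k x hx
    exact ⟨DirectSum.of (fun k => gr k) k ⟨x, hx⟩, DirectSum.coeAddMonoidHom_of _ _ _⟩

variable {n r : ℕ} {e : Module.Basis (Fin n) K V} {u : Fin r → Finset (Fin n)}

theorem mem_Fgr {i : ℕ} {k : ℤ} {z : FMod e u i} :
    z ∈ Fgr e u i k ↔ ∀ p, z p ∈ degPart K V (k - fdeg e u i p) := by
  simp [Fgr, AddSubgroup.mem_iInf]

theorem single_mem_Fgr {i : ℕ} {k : ℤ} {p : FIdx e u i} {x : ExteriorAlgebra K V}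
    (hx : x ∈ degPart K V (k - fdeg e u i p)) :
    (Finsupp.single p x : FMod e u i) ∈ Fgr e u i k := by
  rw [mem_Fgr]
  intro q
  rw [Finsupp.single_apply]
  split_ifs with h
  · exact h ▸ hx
  · exact zero_mem _

theorem smul_mem_Fgr {i : ℕ} {k l : ℤ} {x : ExteriorAlgebra K V} (hx : x ∈ degPart K V k)
    {z : FMod e u i} (hz : z ∈ Fgr e u i l) : x • z ∈ Fgr e u i (k + l) := by
  rw [mem_Fgr] at hz ⊢
  intro p
  rw [add_sub_assoc]
  exact mul_mem_degPart hx (hz p)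

theorem isGradedModule_Fgr (i : ℕ) : IsGradedModule (K := K) (V := V) (Fgr e u i) := by
  refine ⟨?_, fun k l x hx m hm => smul_mem_Fgr hx hm⟩
  refine isInternal_of_projections _ (N := FIdx e u i → ExteriorAlgebra K V)
    (fun k => AddMonoidHom.pi fun p =>
      (degProj K V (k - fdeg e u i p)).comp (Finsupp.applyAddHom p)) ?_ ?_ ?_
  · intro k z hz h
    refine Finsupp.ext fun p => ?_
    have h1 := congrFun h p
    change degProj K V (k - fdeg e u i p) (z p) = 0 at h1
    rwa [degProj_of_mem (mem_Fgr.1 hz p)] at h1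
  · intro k l z hz hlk
    funext p
    exact degProj_of_mem_ne (mem_Fgr.1 hz p) (by omega)
  · rw [eq_top_iff]
    rintro z -
    induction z using Finsupp.induction_linear with
    | zero => exact zero_mem _
    | add x y hx hy => exact add_mem hx hy
    | single p x =>
      induction x using DirectSum.Decomposition.inductionOn (fun i : ℕ => ⋀[K]^i V) with
      | zero => simp
      | add x y hx hy =>
        rw [Finsupp.single_add]
        exact add_mem hx hy
      | @homogeneous k x =>
        refine AddSubgroup.mem_iSup_of_mem ((k : ℤ) + fdeg e u i p) (single_mem_Fgr ?_)
        rw [add_sub_cancel_right, mem_degPart_natCast]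
        exact x.2

theorem isGradedFree_Fgr (i : ℕ) : IsGradedFree K V (Fgr e u i) := by
  have hb : (fun p => (Finsupp.single p 1 : FMod e u i)) =
      ⇑(Finsupp.basisSingleOne (R := ExteriorAlgebra K V) (ι := FIdx e u i)) := by
    rw [Finsupp.coe_basisSingleOne]
  refine ⟨Set.range fun p => Finsupp.single p 1, ?_, ?_, ?_⟩
  · rintro _ ⟨p, rfl⟩
    exact ⟨fdeg e u i p, single_mem_Fgr (by rw [sub_self]; exact one_mem_degPart)⟩
  · rw [hb]
    exact (Module.Basis.linearIndependent _).linearIndepOn_id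
  · rw [hb]
    exact Module.Basis.span_eq _

/-- A linear map that is homogeneous on the basis elements is homogeneous. -/
theorem map_mem_of_mem_Fgr {i : ℕ} {N : Type*} [AddCommGroup N] [Module (ExteriorAlgebra K V) N]
    {gr : ℤ → AddSubgroup N}
    (hgr : ∀ (k l : ℤ), ∀ x ∈ degPart K V k, ∀ m ∈ gr l, x • m ∈ gr (k + l))
    (φ : FMod e u i →ₗ[ExteriorAlgebra K V] N)
    (h : ∀ p, φ (Finsupp.single p 1) ∈ gr (fdeg e u i p)) {k : ℤ} {z : FMod e u i}
    (hz : z ∈ Fgr e u i k) : φ z ∈ gr k := by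
  rw [← Finsupp.sum_single z, map_finsuppSum]
  refine sum_mem fun p _ => ?_
  have := hgr _ _ _ (mem_Fgr.1 hz p) _ (h p)
  rwa [sub_add_cancel, ← map_smul, Finsupp.smul_single, smul_eq_mul, mul_one] at this

theorem symb_mem_Fgr {i : ℕ} {a : Fin n → ℕ} {j : Fin r} {k : ℤ}
    (hk : k = ((∑ l, a l : ℕ) : ℤ) + (u j).card) :
    symb e u (fbasis e u i) a j ∈ Fgr e u (i + 1) k := by
  by_cases h : Admissible e u i a j
  · rw [symb_of_admissible _ h]
    refine single_mem_Fgr ?_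
    change (1 : ExteriorAlgebra K V) ∈ degPart K V (k - (((∑ l, a l : ℕ) : ℤ) + (u j).card))
    rw [hk, sub_self]
    exact one_mem_degPart
  · rw [symb_of_not_admissible _ h]
    exact zero_mem _

theorem quotCoeff_mem_degPart (t : Fin n) (j : Fin r) :
    quotCoeff e u t j ∈ degPart K V ((u j).card + 1 - (u (next e u t j)).card) := by
  by_cases h : t ∈ u j
  · rw [quotCoeff_of_mem h]
    exact zero_mem _
  · obtain ⟨c, hc⟩ := quotCoeff_eq (e := e) h
    have hcard : (insert t (u j) \ u (next e u t j)).card + (u (next e u t j)).card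
        = (u j).card + 1 := by
      rw [Finset.card_sdiff_add_card_eq_card (next_subset h), Finset.card_insert_of_notMem h]
    have hcard' : ((u j).card : ℤ) + 1 - (u (next e u t j)).card =
        ((insert t (u j) \ u (next e u t j)).card : ℕ) := by
      omega
    rw [hc, hcard']
    exact smul_mem_degPart _ (mono_mem_degPart e _)

theorem diffSucc_mem_Fgr {i : ℕ} (a : Fin n → ℕ) (j : Fin r) :
    diffSucc e u (fbasis e u i) a j ∈ Fgr e u (i + 1) (((∑ l, a l : ℕ) : ℤ) + (u j).card) := by
  rw [diffSucc_eq]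
  refine sum_mem fun t ht => ?_
  have hsum := sum_sub_single (a := a) (t := t) (by simpa using ht)
  refine add_mem (neg_mem ?_) ?_
  · have := smul_mem_Fgr (smul_mem_degPart ((-1 : K) ^ (u j).card) (gen_mem_degPart e t))
      (symb_mem_Fgr (e := e) (u := u) (i := i) (a := a - Pi.single t 1) (j := j) rfl)
    convert! this using 2
    push_cast [← hsum]
    ring
  · have := smul_mem_Fgr (quotCoeff_mem_degPart (e := e) (u := u) t j)
      (symb_mem_Fgr (e := e) (u := u) (i := i) (a := a - Pi.single t 1) (j := next e u t j) rfl)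
    convert! this using 2
    push_cast [← hsum]
    ring

theorem fone_mem_Fgr : fone e u ∈ Fgr e u 0 0 :=
  single_mem_Fgr (by simpa [fdeg] using one_mem_degPart)

theorem Fd_fbasis_mem_Fgr (i : ℕ) (p : Idx e u i) :
    Fd e u i (fbasis e u i p) ∈ Fgr e u i (((∑ l, p.1.1 l : ℕ) : ℤ) + (u p.1.2).card) := by
  cases i with
  | zero =>
    rw [Fd_zero_fbasis, p.2.1, Nat.cast_zero, zero_add, ← add_zero ((u p.1.2).card : ℤ)]
    refine smul_mem_Fgr ?_ fone_mem_Fgr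
    rw [diffZero, neg_one_pow_mul_eq_smul]
    exact smul_mem_degPart _ (mono_mem_degPart e _)
  | succ i =>
    rw [Fd_succ_fbasis]
    exact diffSucc_mem_Fgr _ _

theorem Fd_mem_Fgr (i : ℕ) (k : ℤ) (z : FMod e u (i + 1)) (hz : z ∈ Fgr e u (i + 1) k) :
    Fd e u i z ∈ Fgr e u i k := by
  refine map_mem_of_mem_Fgr (fun _ _ _ hx _ hm => smul_mem_Fgr hx hm) (Fd e u i) (fun p => ?_) hz
  exact Fd_fbasis_mem_Fgr i p

theorem Faug_mem_quotDegPart (I : Ideal (ExteriorAlgebra K V)) (k : ℤ) (z : FMod e u 0)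
    (hz : z ∈ Fgr e u 0 k) : Faug e u I z ∈ quotDegPart I k := by
  rw [Faug_apply]
  refine ⟨_, ?_, rfl⟩
  have := mem_Fgr.1 hz (show FIdx e u 0 from ())
  rwa [fdeg, sub_zero] at this

theorem smul_mem_maxIdealSMul (e : Module.Basis (Fin n) K V) {M : Type*} [AddCommGroup M]
    [Module (ExteriorAlgebra K V) M] {x : ExteriorAlgebra K V} (hx : coef e ∅ x = 0) (y : M) :
    x • y ∈ maxIdealSMul K V M := by
  rw [← sum_coef e x, Finset.sum_smul]
  refine Submodule.sum_mem _ fun μ _ => ?_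
  rcases μ.eq_empty_or_nonempty with rfl | ⟨t, ht⟩
  · rw [hx, zero_smul, zero_smul]
    exact Submodule.zero_mem _
  · have h1 := mono_mul_mono e (μ.erase t) {t}
    have h0 := sgn_ne_zero e (show Disjoint (μ.erase t) {t} by simp)
    rw [Finset.union_singleton, Finset.insert_erase ht, mono_singleton] at h1
    have h2 : mono e μ = ((sgn e (μ.erase t) {t})⁻¹ • mono e (μ.erase t)) * gen e t := by
      rw [smul_mul_assoc, h1, smul_smul, inv_mul_cancel₀ h0, one_smul]
    rw [h2, ← smul_mul_assoc, mul_smul]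
    exact Submodule.smul_mem _ _ (Submodule.subset_span ⟨e t, y, rfl⟩)

theorem Fd_fbasis_mem_maxIdealSMul (hanti : ∀ i j, u i ⊆ u j → i = j)
    (hne : ∀ j, (u j).Nonempty) (i : ℕ) (p : Idx e u i) :
    Fd e u i (fbasis e u i p) ∈ maxIdealSMul K V (FMod e u i) := by
  cases i with
  | zero =>
    rw [Fd_zero_fbasis]
    refine smul_mem_maxIdealSMul e ?_ _
    rw [diffZero, neg_one_pow_mul_eq_smul, map_smul, coef_mono, if_neg (hne _).ne_empty,
      smul_zero]
  | succ i =>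
    obtain ⟨⟨a, j⟩, ha⟩ := p
    rw [Fd_succ_fbasis, diffSucc_eq]
    refine Submodule.sum_mem _ fun t ht => ?_
    replace ht : a t ≠ 0 := by simpa using ht
    refine Submodule.add_mem _ (Submodule.neg_mem _ ?_) ?_
    · refine smul_mem_maxIdealSMul e ?_ _
      rw [map_smul, ← mono_singleton, coef_mono, if_neg (by simp), smul_zero]
    · refine smul_mem_maxIdealSMul e ?_ _
      change coef e ∅ (quotCoeff e u t j) = 0
      by_cases htj : t ∈ u j
      · rw [quotCoeff_of_mem htj, map_zero]
      · obtain ⟨c, hc⟩ := quotCoeff_eq (e := e) htj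
        rw [hc, map_smul, coef_mono, if_neg, smul_zero]
        -- A constant quotient would make u_j divide g(e_t u_j), hence equal it, although the latter
        -- has a smaller index.
        rw [Finset.sdiff_eq_empty_iff_subset]
        intro hsub
        exact (next_lt (ha.2 t ht) htj).ne'
          (hanti _ _ ((Finset.subset_insert _ _).trans hsub))

theorem range_Fd_le_maxIdealSMul (hanti : ∀ i j, u i ⊆ u j → i = j)
    (hne : ∀ j, (u j).Nonempty) (i : ℕ) :
    LinearMap.range (Fd e u i) ≤ maxIdealSMul K V (FMod e u i) := by
  rintro _ ⟨z, rfl⟩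
  induction z using Finsupp.induction_linear with
  | zero => simp
  | add x y hx hy =>
    rw [map_add]
    exact Submodule.add_mem _ hx hy
  | single p x =>
    have h := Submodule.smul_mem _ x (Fd_fbasis_mem_maxIdealSMul hanti hne i p)
    rw [← map_smul] at h
    convert! h using 2
    exact (Finsupp.smul_single_one _ _).symm

end Grading

/-! ### Nakayama's lemma and maps between minimal covers. -/

section Nakayama

variable {K V : Type*} [Field K] [AddCommGroup V] [Module K V] {n : ℕ}

theorem degPart_eq_bot_of_lt (e : Module.Basis (Fin n) K V) {k : ℕ} (hk : n < k)
    {x : ExteriorAlgebra K V} (hx : x ∈ ⋀[K]^k V) : x = 0 := by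
  rw [← degProj_of_mem (mem_degPart_natCast.2 hx), ← sum_coef e x, map_sum]
  refine Finset.sum_eq_zero fun μ _ =>
    degProj_of_mem_ne (smul_mem_degPart _ (mono_mem_degPart e μ)) ?_
  have := μ.card_le_univ
  rw [Fintype.card_fin] at this
  omega

variable {M N : Type*} [AddCommGroup M] [Module (ExteriorAlgebra K V) M]
  [AddCommGroup N] [Module (ExteriorAlgebra K V) N]

/-- Nakayama's lemma for the nilpotent ideal `(e_1, …, e_n)`. -/
theorem subsingleton_of_maxIdealSMul_eq_top (e : Module.Basis (Fin n) K V)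
    (h : maxIdealSMul K V M = ⊤) : Subsingleton M := by
  -- Descending induction on degree: E_l annihilates M, trivially for l > n, and finally for l = 0,
  -- where E_0 contains 1. No finiteness of M is needed.
  have key : ∀ (d l : ℕ), n + 1 ≤ l + d → ∀ a ∈ ⋀[K]^l V, ∀ x : M, a • x = 0 := by
    intro d
    induction d with
    | zero =>
      intro l hl a ha x
      rw [degPart_eq_bot_of_lt e (by omega) ha, zero_smul]
    | succ d ih =>
      intro l hl a ha x
      have hx : x ∈ maxIdealSMul K V M := h ▸ Submodule.mem_top
      -- The degree must stay general in the inner induction, since absorbing a homogeneous scalar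
      -- raises it.
      suffices ∀ l, n + 1 ≤ l + (d + 1) → ∀ a ∈ ⋀[K]^l V, a • x = 0 from this l hl a ha
      clear hl ha a l
      induction hx using Submodule.span_induction with
      | mem x hx =>
        obtain ⟨v, y, rfl⟩ := hx
        intro l hl a ha
        rw [smul_smul]
        refine ih (l + 1) (by omega) _ ?_ y
        refine SetLike.GradedMul.mul_mem (A := fun i : ℕ => ⋀[K]^i V) ha ?_
        change _ ∈ LinearMap.range (ExteriorAlgebra.ι K) ^ 1
        rw [pow_one]
        exact ⟨v, rfl⟩
      | zero => simp
      | add x y _ _ hx hy =>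
        intro l hl a ha
        rw [smul_add, hx l hl a ha, hy l hl a ha, add_zero]
      | smul c x _ hx =>
        intro l hl a ha
        rw [smul_smul]
        induction c using DirectSum.Decomposition.inductionOn (fun i : ℕ => ⋀[K]^i V) with
        | zero => simp
        | add c c' hc hc' => rw [mul_add, add_smul, hc, hc', add_zero]
        | @homogeneous m c =>
          exact hx (l + m) (by omega) _
            (SetLike.GradedMul.mul_mem (A := fun i : ℕ => ⋀[K]^i V) ha c.2)
  refine ⟨fun x y => ?_⟩
  have h1 := key (n + 1) 0 (by omega) 1
    (SetLike.GradedOne.one_mem (A := fun i : ℕ => ⋀[K]^i V)) (x - y)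
  rwa [one_smul, sub_eq_zero] at h1

theorem map_mem_maxIdealSMul (φ : M →ₗ[ExteriorAlgebra K V] N) {x : M}
    (hx : x ∈ maxIdealSMul K V M) : φ x ∈ maxIdealSMul K V N := by
  have : maxIdealSMul K V M ≤ (maxIdealSMul K V N).comap φ := by
    refine Submodule.span_le.2 ?_
    rintro _ ⟨v, y, rfl⟩
    change φ _ ∈ maxIdealSMul K V N
    rw [map_smul]
    exact Submodule.subset_span ⟨v, φ y, rfl⟩
  exact this hx

theorem surjective_of_range_sup_maxIdealSMul (e : Module.Basis (Fin n) K V)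
    (φ : M →ₗ[ExteriorAlgebra K V] N) (h : LinearMap.range φ ⊔ maxIdealSMul K V N = ⊤) :
    Function.Surjective φ := by
  rw [← LinearMap.range_eq_top, ← Submodule.Quotient.subsingleton_iff]
  refine subsingleton_of_maxIdealSMul_eq_top e (eq_top_iff.2 ?_)
  rintro q -
  obtain ⟨x, rfl⟩ := Submodule.mkQ_surjective _ q
  have hx : x ∈ LinearMap.range φ ⊔ maxIdealSMul K V N := h ▸ Submodule.mem_top
  obtain ⟨y, hy, z, hz, rfl⟩ := Submodule.mem_sup.1 hx
  rw [map_add, Submodule.mkQ_apply, (Submodule.Quotient.mk_eq_zero _).2 hy, zero_add]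
  exact map_mem_maxIdealSMul _ hz

/-- Projectivity splits the surjection, so projecting M onto the kernel turns containment in
(e_1,…,e_n)M into ker φ = (e_1,…,e_n) ker φ, and Nakayama applies. -/
theorem injective_of_ker_le_maxIdealSMul (e : Module.Basis (Fin n) K V)
    [Module.Projective (ExteriorAlgebra K V) N] (φ : M →ₗ[ExteriorAlgebra K V] N)
    (hsurj : Function.Surjective φ) (h : LinearMap.ker φ ≤ maxIdealSMul K V M) :
    Function.Injective φ := by
  obtain ⟨s, hs⟩ := Module.projective_lifting_property φ LinearMap.id hsurj
  have hs' : ∀ y, φ (s y) = y := fun y => LinearMap.congr_fun hs y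
  set π : M →ₗ[ExteriorAlgebra K V] LinearMap.ker φ :=
    (LinearMap.id - s ∘ₗ φ).codRestrict (LinearMap.ker φ) fun x => by simp [hs'] with hπ
  have hπ_apply : ∀ x : LinearMap.ker φ, π x = x := fun x => Subtype.ext (by simp [hπ])
  rw [← LinearMap.ker_eq_bot, ← Submodule.subsingleton_iff_eq_bot]
  refine subsingleton_of_maxIdealSMul_eq_top e (eq_top_iff.2 ?_)
  rintro x -
  rw [← hπ_apply x]
  exact map_mem_maxIdealSMul _ (h x.2)

/-- A map between minimal covers that lifts an isomorphism of the covered modules is an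
isomorphism, and identifies the kernels of the covers. -/
theorem bijective_of_minimal_covers (e : Module.Basis (Fin n) K V)
    [Module.Projective (ExteriorAlgebra K V) N]
    {Q Q' : Type*} [AddCommGroup Q] [Module (ExteriorAlgebra K V) Q]
    [AddCommGroup Q'] [Module (ExteriorAlgebra K V) Q']
    (p : M →ₗ[ExteriorAlgebra K V] Q) (q : N →ₗ[ExteriorAlgebra K V] Q')
    (φ : M →ₗ[ExteriorAlgebra K V] N) (θ : Q →ₗ[ExteriorAlgebra K V] Q')
    (hθ : Function.Injective θ) (hcomm : ∀ x, q (φ x) = θ (p x)) (hq : ∀ y, ∃ x, q y = θ (p x))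
    (hpmin : LinearMap.ker p ≤ maxIdealSMul K V M)
    (hqmin : LinearMap.ker q ≤ maxIdealSMul K V N) :
    Function.Bijective φ ∧ (LinearMap.ker p).map φ = LinearMap.ker q := by
  have hsurj : Function.Surjective φ := by
    refine surjective_of_range_sup_maxIdealSMul e φ (eq_top_iff.2 ?_)
    rintro y -
    obtain ⟨x, hx⟩ := hq y
    rw [← hcomm] at hx
    rw [← add_sub_cancel (φ x) y]
    exact Submodule.add_mem_sup ⟨x, rfl⟩ (hqmin (by rw [LinearMap.mem_ker, map_sub, hx, sub_self]))
  have hker : ∀ x, q (φ x) = 0 ↔ p x = 0 := fun x => by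
    rw [hcomm, map_eq_zero_iff θ hθ]
  refine ⟨⟨injective_of_ker_le_maxIdealSMul e φ hsurj fun x hx => hpmin ?_, hsurj⟩, ?_⟩
  · rw [LinearMap.mem_ker] at hx ⊢
    rw [← hker, hx, map_zero]
  · apply le_antisymm
    · rintro _ ⟨x, hx, rfl⟩
      exact (hker x).2 hx
    · intro y hy
      obtain ⟨x, rfl⟩ := hsurj y
      exact ⟨x, (hker x).1 hy, rfl⟩

theorem projective_of_isGradedFree {gr : ℤ → AddSubgroup M} (h : IsGradedFree K V gr) :
    Module.Projective (ExteriorAlgebra K V) M := by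
  obtain ⟨s, -, hli, hspan⟩ := h
  have := Module.Free.of_basis (Module.Basis.mk hli (by rw [Subtype.range_coe, hspan]))
  infer_instance

end Nakayama

/-! ### Homogeneous preimages. -/

section Homogeneous

/-- A graded map commutes with taking components, so the degree-k component of any preimage works.
On the target only independence of the pieces is used. -/
theorem exists_homogeneous_preimage {X Y F : Type*} [AddCommGroup X] [AddCommGroup Y]
    [FunLike F X Y] [AddMonoidHomClass F X Y]
    {grX : ℤ → AddSubgroup X} {grY : ℤ → AddSubgroup Y} (hX : DirectSum.IsInternal grX)
    (hY : Function.Injective (DirectSum.coeAddMonoidHom grY)) (f : F)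
    (hf : ∀ k, ∀ x ∈ grX k, f x ∈ grY k) {k : ℤ} {y : X} (hy : f y ∈ grY k) :
    ∃ x ∈ grX k, f x = f y := by
  obtain ⟨x, rfl⟩ := hX.2 y
  set D : (DirectSum ℤ fun k => grX k) →+ DirectSum ℤ fun k => grY k :=
    DirectSum.map fun k => ((f : X →+ Y).comp (grX k).subtype).codRestrict (grY k)
      fun x => hf k x x.2 with hD
  have hcomm : ∀ x, DirectSum.coeAddMonoidHom grY (D x) = f (DirectSum.coeAddMonoidHom grX x) := by
    intro x
    induction x using DirectSum.induction_on with
    | zero => simp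
    | of l z =>
      rw [hD, DirectSum.map_of, DirectSum.coeAddMonoidHom_of, DirectSum.coeAddMonoidHom_of]
      rfl
    | add x y hx hy => rw [map_add, map_add, hx, hy, map_add, map_add]
  have h1 : D x = DirectSum.of (fun k => grY k) k ⟨_, hy⟩ := by
    apply hY
    rw [hcomm, DirectSum.coeAddMonoidHom_of]
  refine ⟨x k, (x k).2, ?_⟩
  have h2 := congrArg (fun z => ((z k : grY k) : Y)) h1
  simp only [DirectSum.of_eq_same] at h2
  rw [← h2, hD, DirectSum.map_apply]
  rfl

variable {K V : Type*} [Field K] [AddCommGroup V] [Module K V] {n : ℕ}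

theorem degProj_mem_of_isMonomialIdeal {e : Module.Basis (Fin n) K V}
    {I : Ideal (ExteriorAlgebra K V)} (hI : IsMonomialIdeal e I) (k : ℤ)
    {x : ExteriorAlgebra K V} (hx : x ∈ I) : degProj K V k x ∈ I := by
  obtain ⟨A, rfl⟩ := hI
  rw [mem_span_mono] at hx
  rw [← sum_coef e x, map_sum]
  refine Submodule.sum_mem _ fun μ _ => ?_
  by_cases hk : (μ.card : ℤ) = k
  · rw [degProj_of_mem (hk ▸ smul_mem_degPart _ (mono_mem_degPart e μ))]
    by_cases h0 : coef e μ x = 0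
    · rw [h0, zero_smul]
      exact Submodule.zero_mem _
    · exact Submodule.smul_of_tower_mem _ _ ((mono_mem_span_mono e A μ).2 (hx μ h0))
  · rw [degProj_of_mem_ne (smul_mem_degPart _ (mono_mem_degPart e μ)) hk]
    exact Submodule.zero_mem _

/-- A monomial ideal contains the homogeneous components of its elements, so a relation in E/I can
be read degree by degree. -/
theorem injective_coe_quotDegPart {e : Module.Basis (Fin n) K V}
    {I : Ideal (ExteriorAlgebra K V)} (hI : IsMonomialIdeal e I) :
    Function.Injective (DirectSum.coeAddMonoidHom (quotDegPart I)) := by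
  rw [injective_iff_map_eq_zero]
  intro y hy
  have hrep : ∀ k, ∃ x ∈ degPart K V k, Submodule.mkQ I x = y k := fun k => (y k).2
  choose x hx hxy using hrep
  rw [DirectSum.coeAddMonoidHom_eq_dfinsuppSum, DFinsupp.sum] at hy
  simp_rw [← hxy] at hy
  rw [← map_sum, Submodule.mkQ_apply, Submodule.Quotient.mk_eq_zero] at hy
  refine DFinsupp.ext fun k => Subtype.ext ?_
  by_cases hk : k ∈ DFinsupp.support y
  · have h1 := degProj_mem_of_isMonomialIdeal hI k hy
    rw [map_sum, Finset.sum_eq_single k, degProj_of_mem (hx k)] at h1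
    · rw [← hxy, Submodule.mkQ_apply, (Submodule.Quotient.mk_eq_zero I).2 h1]
      rfl
    · exact fun l _ hl => degProj_of_mem_ne (hx l) hl
    · exact fun h => absurd hk h
  · rw [DFinsupp.notMem_support_iff.1 hk]
    rfl

end Homogeneous

theorem exists_seq_of_step {α : ℕ → Type*} (P : ∀ i, α i → Prop) (R : ∀ i, α i → α (i + 1) → Prop)
    (hstep : ∀ i x, P i x → ∃ y, P (i + 1) y ∧ R i x y) (x₀ : α 0) (h₀ : P 0 x₀) :
    ∃ x : ∀ i, α i, x 0 = x₀ ∧ (∀ i, P i (x i)) ∧ ∀ i, R i (x i) (x (i + 1)) := by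
  choose g hgP hgR using hstep
  let x : ∀ i, {a : α i // P i a} := fun i =>
    Nat.rec ⟨x₀, h₀⟩ (fun i y => ⟨g i y.1 y.2, hgP i y.1 y.2⟩) i
  exact ⟨fun i => (x i).1, rfl, fun i => (x i).2, fun i => hgR i _ (x i).2⟩

/-! ### Comparison with an arbitrary minimal resolution. -/

section Comparison

variable {K V : Type*} [Field K] [AddCommGroup V] [Module K V] {n r : ℕ}
  {e : Module.Basis (Fin n) K V} {u : Fin r → Finset (Fin n)} {I : Ideal (ExteriorAlgebra K V)}

theorem isMinimalGradedFreeResolution_Fd (hI : IsMonomialIdeal e I) (hproper : I ≠ ⊤)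
    (hu : EnumeratesMinGens e I u) (hlin : HasLinearQuotients e u) (hreg : IsRegularDecomp e u) :
    IsMinimalGradedFreeResolution I (Fgr e u) (Fd e u) (Faug e u I) where
  graded := isGradedModule_Fgr
  free := isGradedFree_Fgr
  d_homogeneous := Fd_mem_Fgr
  aug_homogeneous := Faug_mem_quotDegPart I
  aug_surjective := Faug_surjective I
  exact_zero := range_Fd_zero_eq_ker hI hu
  exact_succ := range_Fd_succ_eq_ker (antichain_of_enumerates hu) hlin hreg
  minimal := range_Fd_le_maxIdealSMul (antichain_of_enumerates hu)
    (nonempty_of_enumerates hproper hu)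

variable {X : ℕ → Type*} [∀ i, AddCommGroup (X i)] [∀ i, Module (ExteriorAlgebra K V) (X i)]
  {gr : ∀ i, ℤ → AddSubgroup (X i)} {d : ∀ i, X (i + 1) →ₗ[ExteriorAlgebra K V] X i}
  {aug : X 0 →ₗ[ExteriorAlgebra K V] ExteriorAlgebra K V ⧸ I}

/-- An isomorphism of `F_i` with `X_i` that can be continued to the left. -/
def IsComparison (e : Module.Basis (Fin n) K V) (u : Fin r → Finset (Fin n))
    (gr : ∀ i, ℤ → AddSubgroup (X i)) (d : ∀ i, X (i + 1) →ₗ[ExteriorAlgebra K V] X i) (i : ℕ)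
    (φ : FMod e u i ≃ₗ[ExteriorAlgebra K V] X i) : Prop :=
  (∀ k, ∀ z ∈ Fgr e u i k, φ z ∈ gr i k) ∧
    (LinearMap.range (Fd e u i)).map φ.toLinearMap = LinearMap.range (d i)

theorem exists_comparison_zero (hI : IsMonomialIdeal e I)
    (hF : IsMinimalGradedFreeResolution I (Fgr e u) (Fd e u) (Faug e u I))
    (hX : IsMinimalGradedFreeResolution I gr d aug) :
    ∃ φ : FMod e u 0 ≃ₗ[ExteriorAlgebra K V] X 0, IsComparison e u gr d 0 φ ∧
      aug (φ (fone e u)) = Submodule.mkQ I 1 := by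
  obtain ⟨y, hy⟩ := hX.aug_surjective (Submodule.mkQ I 1)
  obtain ⟨x, hx, hxy⟩ := exists_homogeneous_preimage (hX.graded 0).1
    (injective_coe_quotDegPart hI) aug hX.aug_homogeneous (k := 0) (y := y)
    (hy ▸ ⟨1, one_mem_degPart, rfl⟩)
  rw [hy] at hxy
  set φ : FMod e u 0 →ₗ[ExteriorAlgebra K V] X 0 :=
    Finsupp.linearCombination (ExteriorAlgebra K V) fun _ => x with hφ
  have hφ1 : ∀ p, φ (Finsupp.single p 1) = x := fun p => by simp [hφ]
  have hcomm : ∀ z, aug (φ z) = Faug e u I z := by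
    intro z
    rw [← LinearMap.comp_apply]
    congr 1
    refine Finsupp.lhom_ext' fun p => LinearMap.ext_ring ?_
    simp [hφ1, hxy, Faug]
  have := projective_of_isGradedFree (hX.free 0)
  have hbij := bijective_of_minimal_covers e (Faug e u I) aug φ LinearMap.id
    Function.injective_id hcomm (fun y => by simpa [eq_comm] using hF.aug_surjective (aug y))
    (hF.exact_zero ▸ hF.minimal 0) (hX.exact_zero ▸ hX.minimal 0)
  refine ⟨LinearEquiv.ofBijective φ hbij.1, ⟨fun k z hz => ?_, ?_⟩, ?_⟩
  · refine map_mem_of_mem_Fgr (hX.graded 0).2 φ (fun p => ?_) hz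
    rw [hφ1]
    exact hx
  · rw [hF.exact_zero, hX.exact_zero]
    exact hbij.2
  · change aug (φ _) = _
    rw [fone, hφ1, hxy]

/-- The images of the basis elements are boundaries in X_i and lift homogeneously. The resulting map
covers the isomorphism already built, and minimality of both complexes makes it bijective with
matching kernels, which by exactness are the next images. -/
theorem exists_comparison_succ (e : Module.Basis (Fin n) K V) (u : Fin r → Finset (Fin n))
    (hF : IsMinimalGradedFreeResolution I (Fgr e u) (Fd e u) (Faug e u I))
    (hX : IsMinimalGradedFreeResolution I gr d aug) (i : ℕ)
    (φ : FMod e u i ≃ₗ[ExteriorAlgebra K V] X i) (hφ : IsComparison e u gr d i φ) :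
    ∃ ψ : FMod e u (i + 1) ≃ₗ[ExteriorAlgebra K V] X (i + 1),
      IsComparison e u gr d (i + 1) ψ ∧ ∀ z, d i (ψ z) = φ (Fd e u i z) := by
  have hlift : ∀ p : FIdx e u (i + 1), ∃ x ∈ gr (i + 1) (fdeg e u (i + 1) p),
      d i x = φ (Fd e u i (Finsupp.single p 1)) := by
    intro p
    have h1 : φ (Fd e u i (Finsupp.single p 1)) ∈ LinearMap.range (d i) :=
      hφ.2 ▸ ⟨_, ⟨_, rfl⟩, rfl⟩
    obtain ⟨y, hy⟩ := h1
    have h2 : d i y ∈ gr i (fdeg e u (i + 1) p) := by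
      rw [hy]
      exact hφ.1 _ _ (hF.d_homogeneous i _ _
        (single_mem_Fgr (by rw [sub_self]; exact one_mem_degPart)))
    obtain ⟨x, hx, hxy⟩ := exists_homogeneous_preimage (hX.graded (i + 1)).1 (hX.graded i).1.1
      (d i) (hX.d_homogeneous i) h2
    exact ⟨x, hx, hxy.trans hy⟩
  choose x hx hxd using hlift
  set ψ : FMod e u (i + 1) →ₗ[ExteriorAlgebra K V] X (i + 1) :=
    Finsupp.linearCombination (ExteriorAlgebra K V) x with hψ
  have hψ1 : ∀ p, ψ (Finsupp.single p 1) = x p := fun p => by simp [hψ]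
  have hcomm : ∀ z, d i (ψ z) = φ.toLinearMap (Fd e u i z) := by
    intro z
    rw [← LinearMap.comp_apply, ← LinearMap.comp_apply]
    congr 1
    refine Finsupp.lhom_ext' fun p => LinearMap.ext_ring ?_
    simp only [LinearMap.comp_apply, Finsupp.lsingle_apply, hψ1, hxd]
    rfl
  have := projective_of_isGradedFree (hX.free (i + 1))
  have hbij := bijective_of_minimal_covers e (Fd e u i) (d i) ψ φ.toLinearMap φ.injective hcomm
    (fun y => by
      have h1 : d i y ∈ (LinearMap.range (Fd e u i)).map φ.toLinearMap := hφ.2 ▸ ⟨y, rfl⟩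
      obtain ⟨_, ⟨z, rfl⟩, hz⟩ := h1
      exact ⟨z, hz.symm⟩)
    (hF.exact_succ i ▸ hF.minimal (i + 1)) (hX.exact_succ i ▸ hX.minimal (i + 1))
  refine ⟨LinearEquiv.ofBijective ψ hbij.1, ⟨fun k z hz => ?_, ?_⟩, hcomm⟩
  · refine map_mem_of_mem_Fgr (hX.graded (i + 1)).2 ψ (fun p => ?_) hz
    rw [hψ1]
    exact hx p
  · rw [hF.exact_succ, hX.exact_succ]
    exact hbij.2

end Comparison

end

end ExtRes

theorem theorem4p4 {K V : Type*} [Field K] [AddCommGroup V] [Module K V] {n r : ℕ}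
    (e : Module.Basis (Fin n) K V)
    (I : Ideal (ExteriorAlgebra K V)) (hI : IsMonomialIdeal e I) (hproper : I ≠ ⊤)
    (u : Fin r → Finset (Fin n)) (hu : EnumeratesMinGens e I u)
    (hlin : HasLinearQuotients e u) (hreg : IsRegularDecomp e u) :
    -- the explicit complex is a minimal graded free resolution of `E/I`
    IsMinimalGradedFreeResolution I (Fgr e u) (Fd e u) (Faug e u I) ∧
    -- every minimal graded free resolution of `E/I` is given by the same formulas
    ∀ {X : ℕ → Type*} [∀ i, AddCommGroup (X i)] [∀ i, Module (ExteriorAlgebra K V) (X i)]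
      (gr : ∀ i, ℤ → AddSubgroup (X i))
      (d : ∀ i, X (i + 1) →ₗ[ExteriorAlgebra K V] X i)
      (aug : X 0 →ₗ[ExteriorAlgebra K V] ExteriorAlgebra K V ⧸ I),
      IsMinimalGradedFreeResolution I gr d aug →
      ∃ (one : Module.Basis Unit (ExteriorAlgebra K V) (X 0))
        (f : ∀ i, Module.Basis (Idx e u i) (ExteriorAlgebra K V) (X (i + 1))),
        (one () ∈ gr 0 0 ∧ aug (one ()) = Submodule.mkQ I 1) ∧
        (∀ i (p : Idx e u i),
          f i p ∈ gr (i + 1) (((∑ k, p.1.1 k : ℕ) : ℤ) + ((u p.1.2).card : ℤ))) ∧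
        (∀ p : Idx e u 0, d 0 (f 0 p) = diffZero e u p.1.2 • one ()) ∧
        (∀ i (p : Idx e u (i + 1)), d (i + 1) (f (i + 1) p) = diffSucc e u (f i) p.1.1 p.1.2) := by
  have hF := isMinimalGradedFreeResolution_Fd hI hproper hu hlin hreg
  refine ⟨hF, ?_⟩
  intro X _ _ gr d aug hX
  obtain ⟨φ₀, hφ₀, haug⟩ := exists_comparison_zero hI hF hX
  obtain ⟨φ, hφ0, hφ, hcomm⟩ := exists_seq_of_step
    (α := fun i => FMod e u i ≃ₗ[ExteriorAlgebra K V] X i) (IsComparison e u gr d)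
    (fun i φ ψ => ∀ z, d i (ψ z) = φ (Fd e u i z)) (exists_comparison_succ e u hF hX) φ₀ hφ₀
  subst hφ0
  -- The bases are the images of the standard bases of F_0 and F_{i+1} under the comparison
  -- isomorphisms.
  let one : Module.Basis Unit (ExteriorAlgebra K V) (X 0) := Module.Basis.ofRepr (φ 0).symm
  let f : ∀ i, Module.Basis (Idx e u i) (ExteriorAlgebra K V) (X (i + 1)) :=
    fun i => Module.Basis.ofRepr (φ (i + 1)).symm
  have hone : one () = φ 0 (fone e u) := rfl
  have hf : ∀ i p, f i p = φ (i + 1) (fbasis e u i p) := fun i p => rfl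
  refine ⟨one, f, ⟨?_, ?_⟩, fun i p => ?_, fun p => ?_, fun i p => ?_⟩
  · rw [hone]
    exact (hφ 0).1 _ _ fone_mem_Fgr
  · rw [hone, haug]
  · rw [hf, ← symb_of_admissible (fbasis e u i) p.2]
    exact (hφ (i + 1)).1 _ _ (symb_mem_Fgr rfl)
  · rw [hf, hcomm, Fd_zero_fbasis, map_smul, hone]
  · rw [hf, hcomm, Fd_succ_fbasis]
    exact map_diffSucc (φ (i + 1)).toLinearMap _ _ _
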